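/- **Theorem (Milnor–Wood inequality).** Let $g,n\ge 0$ and let $S$ be the compact connected oriented surface of genus $g$ with $n$ boundary components, with $$\pi_1(S)=\langle \alpha_1,\beta_1,\dots,\alpha_g,\beta_g,\gamma_1,\dots,\gamma_n \mid [\alpha_1,\beta_1]\cdots[\alpha_g,\beta_g]\,\gamma_1\cdots\gamma_n=1\rangle ,$$ where $\gamma_j$ is the class of the $j$-th boundary component, and $\chi(S)=2-2g-n$. Let $p_2:\widetilde{PSL_2\mathbb R}\to PSL_2\mathbb R=\mathrm{Isom}^+(\mathbb H^2)$ be the universal covering group, whose elements are the homotopy classes (with fixed end points) of paths in $PSL_2\mathbb R$ starting at $1$, and let $z\in\ker p_2$ be the class of one full anticlockwise turn about a point of $\mathbb H^2$. For $\tilde\alpha\in\widetilde{PSL_2\mathbb R}$ over $\alpha$ and $y\in\mathbb H^2$, let $\mathrm{Twist}(\tilde\alpha,y)\in\mathbb R$ be the total anticlockwise angle through which $V$ turns relative to parallel translation along the geodesic from $y$ to $\alpha(y)$ (equivalently, relative to the velocity direction, if $\alpha(y)\ne y$), where $V$ is any field of unit tangent vectors along this geodesic of the form $V(t)=f(t)_*V(0)$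 with a path $f$ of isometries, $f(0)=1$, in the class $\tilde\alpha$. Let $\rho:\pi_1(S)\to PSL_2\mathbb R$ be a representation, and for $1\le j\le n$ let $\tilde\gamma_j\in\widetilde{PSL_2\mathbb R}$ be a lift of $\rho(\gamma_j)$ such that $|\mathrm{Twist}(\tilde\gamma_j,p)|<\pi$ at some point $p\in\mathbb H^2$ (the point may depend on $j$). Then there is a unique Euler class $\mathcal E(\rho)\in H^2(S,\partial S;\mathbb Z)$ of $\rho$ relative to the lifts $\tilde\gamma_j$, namely the obstruction class whose value on the $2$-cell of the standard polygonal cell structure of $S$ is the integer $m$ such that the product around the boundary of the $2$-cell of lifts to $\widetilde{PSL_2\mathbb R}$ of the holonomies of the edges, the lift along the $j$-th boundary circle being $\tilde\gamma_j$, is $z^m$. Its value $m$ on the fundamental class $[S]\in H_2(S,\partial S;\mathbb Z)$ satisfies $|m|\le|\chi(S)|$. -/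

import Mathlib

open scoped UpperHalfPlane MatrixGroups unitInterval

noncomputable section

namespace MilnorWood

/-! ## The unit tangent bundle of the hyperbolic plane -/

/-- A unit tangent vector of the upper half-plane `ℍ` with the metric `|dz|² / (Im z)²`: a base
point and a tangent vector `vec ∈ ℂ` whose hyperbolic length `‖vec‖ / Im base` is `1`. -/
@[ext]
structure UnitTangent where
  base : ℍ
  vec : ℂ
  norm_vec : ‖vec‖ = base.im

/-- The denominator `c z + d` of the Möbius transformation of a matrix. -/
def den (A : SL(2, ℝ)) (z : ℍ) : ℂ := (A 1 0 : ℂ) * z + (A 1 1 : ℂ)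

theorem den_eq (A : SL(2, ℝ)) (z : ℍ) :
    den A z = UpperHalfPlane.denom (Matrix.SpecialLinearGroup.mapGL ℝ A) z := by
  simp [den, UpperHalfPlane.denom]

theorem den_ne_zero (A : SL(2, ℝ)) (z : ℍ) : den A z ≠ 0 := by
  rw [den_eq]; exact UpperHalfPlane.denom_ne_zero _ _

theorem im_smul (A : SL(2, ℝ)) (z : ℍ) : (A • z).im = z.im / ‖den A z‖ ^ 2 := by
  rw [← Complex.normSq_eq_norm_sq, den_eq]
  have h := UpperHalfPlane.im_smul_eq_div_normSq (Matrix.SpecialLinearGroup.mapGL ℝ A) z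
  rw [MulAction.compHom_smul_def, h]
  simp

theorem coe_smul (A : SL(2, ℝ)) (z : ℍ) :
    ((A • z : ℍ) : ℂ) = ((A 0 0 : ℂ) * z + (A 0 1 : ℂ)) / den A z := by
  simp [UpperHalfPlane.coe_specialLinearGroup_apply, den]

theorem den_mul (A B : SL(2, ℝ)) (z : ℍ) : den (A * B) z = den A (B • z) * den B z := by
  have h := den_ne_zero B z
  have e : den A (B • z) * den B z
      = (A 1 0 : ℂ) * ((B 0 0 : ℂ) * z + (B 0 1 : ℂ)) + (A 1 1 : ℂ) * den B z := by
    conv_lhs => rw [den, coe_smul]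
    field_simp
  rw [e]
  simp only [den, Matrix.SpecialLinearGroup.coe_mul, Matrix.mul_apply, Fin.sum_univ_two]
  push_cast
  ring

/-- `SL(2, ℝ)` acts on unit tangent vectors through the derivatives of its Möbius transformations
`z ↦ (a z + b) / (c z + d)`, whose derivative at `z` is `1 / (c z + d)²`. -/
instance : MulAction SL(2, ℝ) UnitTangent where
  smul A V := ⟨A • V.base, V.vec / den A V.base ^ 2, by
    rw [norm_div, norm_pow, V.norm_vec, im_smul]⟩
  one_smul V := by
    refine UnitTangent.ext (one_smul _ _) ?_
    change V.vec / den 1 V.base ^ 2 = V.vec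
    simp [den]
  mul_smul A B V := by
    refine UnitTangent.ext (mul_smul _ _ _) ?_
    change V.vec / den (A * B) V.base ^ 2 = V.vec / den B V.base ^ 2 / den A (B • V.base) ^ 2
    rw [den_mul, mul_pow, div_div, mul_comm]

theorem smul_base (A : SL(2, ℝ)) (V : UnitTangent) : (A • V).base = A • V.base := rfl

theorem smul_vec (A : SL(2, ℝ)) (V : UnitTangent) :
    (A • V).vec = V.vec / den A V.base ^ 2 := rfl

/-- The vector obtained from `V` by turning it anticlockwise through the angle `θ`. -/
def UnitTangent.rotate (V : UnitTangent) (θ : ℝ) : UnitTangent :=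
  ⟨V.base, Complex.exp (θ * Complex.I) * V.vec, by
    rw [norm_mul, Complex.norm_exp_ofReal_mul_I, one_mul, V.norm_vec]⟩

/-- `PSL₂ℝ`, the group of orientation-preserving isometries of `ℍ`; it carries the quotient
topology. -/
abbrev PSL := Matrix.ProjectiveSpecialLinearGroup (Fin 2) ℝ

instance : IsTopologicalGroup PSL :=
  inferInstanceAs (IsTopologicalGroup (SL(2, ℝ) ⧸ Subgroup.center SL(2, ℝ)))

theorem center_smul (A : SL(2, ℝ)) (hA : A ∈ Subgroup.center SL(2, ℝ)) (V : UnitTangent) :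
    A • V = V := by
  obtain ⟨r, hr, hA⟩ := Matrix.SpecialLinearGroup.mem_center_iff.mp hA
  have h00 : A 0 0 = r := by rw [← hA]; simp
  have h01 : A 0 1 = 0 := by rw [← hA]; simp
  have h10 : A 1 0 = 0 := by rw [← hA]; simp
  have h11 : A 1 1 = r := by rw [← hA]; simp
  have hr2 : (r : ℂ) ^ 2 = 1 := by
    have : r ^ 2 = 1 := by simpa using hr
    exact_mod_cast this
  have hr0 : (r : ℂ) ≠ 0 := by
    intro h
    simp [h] at hr2
  refine UnitTangent.ext (UpperHalfPlane.ext ?_) ?_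
  · rw [smul_base, coe_smul, den, h00, h01, h10, h11]
    simp [hr0]
  · rw [smul_vec, den, h10, h11]
    simp [hr2]

/-- The action of `PSL₂ℝ` on unit tangent vectors induced from that of `SL(2, ℝ)`. -/
instance : MulAction PSL UnitTangent :=
  MulAction.compHom UnitTangent
    (QuotientGroup.lift (Subgroup.center SL(2, ℝ)) (MulAction.toPermHom SL(2, ℝ) UnitTangent)
      (fun A hA => Equiv.ext (fun V => center_smul A hA V)))

theorem mk_smul (A : SL(2, ℝ)) (V : UnitTangent) :
    (QuotientGroup.mk A : PSL) • V = A • V := rfl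

/-! ## The universal covering group of `PSL₂ℝ` -/

/-- The group (under pointwise multiplication) of paths `[0,1] → PSL₂ℝ` starting at `1`. -/
def BasedPath : Subgroup C(I, PSL) where
  carrier := {f | f 0 = 1}
  mul_mem' {f g} hf hg := by
    simp only [Set.mem_ofPred_eq] at hf hg ⊢
    rw [ContinuousMap.mul_apply, hf, hg, one_mul]
  one_mem' := rfl
  inv_mem' {f} hf := by
    simp only [Set.mem_ofPred_eq] at hf ⊢
    rw [ContinuousMap.inv_apply, hf, inv_one]

theorem homotopicRel_mul {f₁ f₂ g₁ g₂ : C(I, PSL)}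
    (hf : f₁.HomotopicRel f₂ {0, 1}) (hg : g₁.HomotopicRel g₂ {0, 1}) :
    (f₁ * g₁).HomotopicRel (f₂ * g₂) {0, 1} := by
  obtain ⟨F⟩ := hf
  obtain ⟨G⟩ := hg
  refine ⟨⟨⟨⟨fun p => F p * G p, by fun_prop⟩, ?_, ?_⟩, ?_⟩⟩
  · intro x; simp
  · intro x; simp
  · intro t x hx
    exact congrArg₂ (· * ·) (F.eq_fst t hx) (G.eq_fst t hx)

/-- Homotopy of paths relative to their end points. -/
def pathHomotopy : Con BasedPath where
  r f g := (f : C(I, PSL)).HomotopicRel g {0, 1}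
  iseqv := ⟨fun _ => .refl _, fun h => h.symm, fun h k => h.trans k⟩
  mul' h k := homotopicRel_mul h k

/-- The universal covering group of `PSL₂ℝ`: homotopy classes, relative to the end points, of
paths in `PSL₂ℝ` starting at `1`, multiplied pointwise. -/
abbrev PSLTilde := pathHomotopy.Quotient

/-- The covering homomorphism, which sends the class of a path to its end point. -/
def proj : PSLTilde →* PSL :=
  pathHomotopy.lift
    { toFun := fun f => (f : C(I, PSL)) 1
      map_one' := rfl
      map_mul' := fun _ _ => rfl }
    (fun _ _ h => h.fst_eq_snd (by simp))

/-- The matrix acting on `ℍ` as the anticlockwise rotation through the angle `2 s` about `i`. -/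
def rotMatrix (s : ℝ) : SL(2, ℝ) :=
  ⟨!![Real.cos s, Real.sin s; -Real.sin s, Real.cos s], by
    rw [Matrix.det_fin_two_of]; nlinarith [Real.sin_sq_add_cos_sq s]⟩

theorem continuous_rotMatrix : Continuous rotMatrix := by
  refine Continuous.subtype_mk ?_ _
  refine continuous_matrix fun i j => ?_
  fin_cases i <;> fin_cases j <;> simp <;> fun_prop

/-- The path of rotations about `i` through the angles `2 π t`, `0 ≤ t ≤ 1`. -/
def fullTurn : BasedPath :=
  ⟨⟨fun t => QuotientGroup.mk (rotMatrix (Real.pi * t)),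
      continuous_quot_mk.comp (continuous_rotMatrix.comp (by fun_prop))⟩, by
    change (QuotientGroup.mk (rotMatrix (Real.pi * ((0 : I) : ℝ))) : PSL) = 1
    have : rotMatrix (Real.pi * ((0 : I) : ℝ)) = 1 := by
      ext i j
      fin_cases i <;> fin_cases j <;> simp [rotMatrix]
    rw [this]; rfl⟩

/-- The generator `z` of the group of lifts of `1 ∈ PSL₂ℝ`: one full anticlockwise turn. -/
def zeta : PSLTilde := (fullTurn : pathHomotopy.Quotient)

/-! ## The twist -/

/-- The upward unit tangent vector at the point `i e^s` of the imaginary axis; as `s` varies, the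
base point moves along this geodesic with unit speed, and the vector is its velocity. -/
def upward (s : ℝ) : UnitTangent :=
  ⟨⟨⟨0, Real.exp s⟩, Real.exp_pos s⟩, ⟨0, Real.exp s⟩, by
    change ‖(⟨0, Real.exp s⟩ : ℂ)‖ = Real.exp s
    have h : (⟨0, Real.exp s⟩ : ℂ) = (Real.exp s : ℝ) * Complex.I := by
      apply Complex.ext <;> simp [-Complex.ofReal_exp]
    rw [h, norm_mul, Complex.norm_I, mul_one, Complex.norm_real, Real.norm_of_nonneg
      (Real.exp_pos s).le]⟩

/-- The unit tangent field along a geodesic `t ↦ A • (i e^(l t))`, `0 ≤ t ≤ 1`, of constant speed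
`l`, that points in the direction of motion. Every constant speed geodesic segment of `ℍ` has this
form; if `l = 0`, the geodesic is constant and the field is a constant unit vector. In all cases
the field is parallel. -/
def geodesicField (A : SL(2, ℝ)) (l : ℝ) (t : I) : UnitTangent := A • upward (l * t)

/-- `τ` is the twist of the vector field `V` along a curve relative to the unit field `C` along the
same curve: the total increment of a continuous choice of the anticlockwise angle from `C` to
`V`. -/
def IsFieldTwist (C V : I → UnitTangent) (τ : ℝ) : Prop :=
  ∃ θ : C(I, ℝ), (∀ t, V t = (C t).rotate (θ t)) ∧ τ = θ 1 - θ 0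

/-- The path `t ↦ V t` of unit tangent vectors lies in the homotopy class `a`: it is obtained from
its initial vector by a path of isometries that starts at `1` and represents `a`. -/
def LiesInClass (V : I → UnitTangent) (a : PSLTilde) : Prop :=
  ∃ f : BasedPath, (f : pathHomotopy.Quotient) = a ∧ ∀ t, V t = (f : C(I, PSL)) t • V 0

/-- `τ` is the twist, along a constant speed geodesic from `y` (to the image of `y` under `a`), of
some vector field along this geodesic that lies in the homotopy class `a`. -/
def IsTwist (a : PSLTilde) (y : ℍ) (τ : ℝ) : Prop :=
  ∃ (A : SL(2, ℝ)) (l : ℝ) (V : I → UnitTangent), 0 ≤ l ∧ (V 0).base = y ∧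
    LiesInClass V a ∧ IsFieldTwist (geodesicField A l) V τ

/-- `Twist(a, y)`, the (unique) real number `τ` with `IsTwist a y τ`. -/
def twist (a : PSLTilde) (y : ℍ) : ℝ := Classical.epsilon (IsTwist a y)

/-! ## The surface of genus `g` with `n` boundary components -/

/-- The commutator `[x, y] = x y x⁻¹ y⁻¹`. -/
def comm {G : Type*} [Group G] (x y : G) : G := x * y * x⁻¹ * y⁻¹

/-- The generators of the standard presentation of the fundamental group. -/
inductive Generator (g n : ℕ) : Type
  | α (i : Fin g)
  | β (i : Fin g)
  | γ (j : Fin n)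

/-- The relator `[α₁, β₁] ⋯ [α_g, β_g] γ₁ ⋯ γ_n`. -/
def relator (g n : ℕ) : FreeGroup (Generator g n) :=
  (List.ofFn fun i : Fin g => comm (FreeGroup.of (.α i)) (FreeGroup.of (.β i))).prod *
    (List.ofFn fun j : Fin n => FreeGroup.of (.γ j)).prod

/-- The fundamental group `π₁(S)` of the compact connected oriented surface `S` of genus `g` with
`n` boundary components, given by its standard presentation. -/
abbrev SurfaceGroup (g n : ℕ) := PresentedGroup {relator g n}

/-- The class in `π₁(S)` of the `j`-th boundary component. -/
def boundaryClass {g n : ℕ} (j : Fin n) : SurfaceGroup g n := PresentedGroup.of (.γ j)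

/-! The standard cell structure on `S`: a polygon with sides glued according to the word
`[a₁, b₁] ⋯ [a_g, b_g] (d₁ c₁ d₁⁻¹) ⋯ (d_n c_n d_n⁻¹)`. The `j`-th boundary circle is formed by the
vertex `w_j` and the loop `c_j`, and `d_j` is an arc from the base vertex to `w_j`. -/

/-- The vertices: the base vertex and a vertex on every boundary circle. -/
inductive Vertex (n : ℕ) : Type
  | base
  | w (j : Fin n)

/-- The oriented edges. -/
inductive Edge (g n : ℕ) : Type
  | a (i : Fin g)
  | b (i : Fin g)
  | c (j : Fin n)
  | d (j : Fin n)

/-- The oriented faces: a single polygon. -/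
abbrev Face := Unit

/-- The word in the edges along which the boundary of a face is attached. -/
def attachingWord (g n : ℕ) : Face → FreeGroup (Edge g n)
  | () =>
    (List.ofFn fun i : Fin g => comm (FreeGroup.of (.a i)) (FreeGroup.of (.b i))).prod *
      (List.ofFn fun j : Fin n =>
        FreeGroup.of (.d j) * FreeGroup.of (.c j) * (FreeGroup.of (.d j))⁻¹).prod

/-- The Euler characteristic of `S`, the alternating sum of the numbers of cells. -/
def eulerChar (g n : ℕ) : ℤ :=
  (Nat.card (Vertex n) : ℤ) - Nat.card (Edge g n) + Nat.card Face

/-- The class in `π₁(S)` of an edge, once the arcs `d_j` are contracted to the base vertex (they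
form a maximal tree). -/
def edgeClass {g n : ℕ} : Edge g n → SurfaceGroup g n
  | .a i => PresentedGroup.of (.α i)
  | .b i => PresentedGroup.of (.β i)
  | .c j => PresentedGroup.of (.γ j)
  | .d _ => 1

/-! ### Relative cellular cohomology of `(S, ∂S)` and the fundamental class -/

/-- The relative cellular cochains `C¹(S, ∂S; ℤ)`: integer functions on the edges that vanish on the
edges in `∂S`. -/
def RelCochain₁ (g n : ℕ) : AddSubgroup (Edge g n → ℤ) where
  carrier := {f | ∀ j, f (.c j) = 0}
  add_mem' {f h} hf hh j := by simp [hf j, hh j]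
  zero_mem' _ := rfl
  neg_mem' {f} hf j := by simp [hf j]

/-- The value of a cellular `1`-cochain on a word in the edges: the sum of its values on the letters,
counted with sign. -/
def sumAlong {g n : ℕ} (f : Edge g n → ℤ) (x : FreeGroup (Edge g n)) : ℤ :=
  (FreeGroup.lift (fun e => Multiplicative.ofAdd (f e)) x).toAdd

theorem sumAlong_add {g n : ℕ} (f h : Edge g n → ℤ) (x : FreeGroup (Edge g n)) :
    sumAlong (f + h) x = sumAlong f x + sumAlong h x := by
  have : FreeGroup.lift (fun e => Multiplicative.ofAdd ((f + h) e)) =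
      FreeGroup.lift (fun e => Multiplicative.ofAdd (f e)) *
        FreeGroup.lift (fun e => Multiplicative.ofAdd (h e)) := by
    ext e
    simp
  simp only [sumAlong, this, MonoidHom.mul_apply, toAdd_mul]

/-- The coboundary `C¹(S, ∂S; ℤ) → C²(S, ∂S; ℤ)`; the elements of `C²(S, ∂S; ℤ)` are the integer
functions on the faces. -/
def coboundary (g n : ℕ) : RelCochain₁ g n →+ (Face → ℤ) :=
  AddMonoidHom.mk' (fun f F => sumAlong f.1 (attachingWord g n F))
    (fun f h => funext fun _ => sumAlong_add f.1 h.1 _)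

/-- The relative cellular cohomology group `H²(S, ∂S; ℤ)`; there are no cells of dimension `3`. -/
abbrev RelCohomology₂ (g n : ℕ) := (Face → ℤ) ⧸ (coboundary g n).range

theorem coboundary_eq_zero {g n : ℕ} (f : RelCochain₁ g n) : coboundary g n f = 0 := by
  funext F
  cases F
  change (FreeGroup.lift (fun e => Multiplicative.ofAdd (f.1 e)) _).toAdd = 0
  have h1 : ∀ i : Fin g, FreeGroup.lift (fun e => Multiplicative.ofAdd (f.1 e))
      (comm (FreeGroup.of (Edge.a (n := n) i)) (FreeGroup.of (.b i))) = 1 := fun i => by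
    simp only [comm, map_mul, map_inv]
    rw [mul_assoc, mul_mul_mul_comm]
    simp
  have h2 : ∀ j : Fin n, FreeGroup.lift (fun e => Multiplicative.ofAdd (f.1 e))
      (FreeGroup.of (Edge.d (g := g) j) * FreeGroup.of (.c j) * (FreeGroup.of (.d j))⁻¹) = 1 :=
    fun j => by simp [f.2 j]
  rw [attachingWord, map_mul, map_list_prod, map_list_prod, List.map_ofFn, List.map_ofFn]
  simp only [Function.comp_def, h1, h2]
  simp

/-- Evaluation of classes in `H²(S, ∂S; ℤ)` on the fundamental class `[S] ∈ H₂(S, ∂S; ℤ)`, which is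
represented by the sum of the oriented faces. -/
def evalFundamental (g n : ℕ) : RelCohomology₂ g n →+ ℤ :=
  QuotientAddGroup.lift (coboundary g n).range
    (AddMonoidHom.mk' (fun o : Face → ℤ => ∑ F, o F)
      (fun o p => by simp [Finset.sum_add_distrib]))
    (by
      rintro _ ⟨f, rfl⟩
      rw [coboundary_eq_zero]
      simp)

/-! ### The relative Euler class -/

/-- `o ∈ C²(S, ∂S; ℤ)` is an obstruction cochain for lifting the flat `PSL₂ℝ`-bundle of `ρ` to the
universal covering group, relative to the lifts `γ j` on the boundary: the holonomies along the edges
are lifted, the lift along the `j`-th boundary circle being `γ j`, and the product of these lifts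
around a face `F`, which lies over `1 ∈ PSL₂ℝ`, equals `z` to the power `o F`. -/
def IsObstructionCochain {g n : ℕ} (ρ : SurfaceGroup g n →* PSL) (γ : Fin n → PSLTilde)
    (o : Face → ℤ) : Prop :=
  ∃ h : Edge g n → PSLTilde, (∀ e, proj (h e) = ρ (edgeClass e)) ∧ (∀ j, h (.c j) = γ j) ∧
    ∀ F, FreeGroup.lift h (attachingWord g n F) = zeta ^ o F

/-- `E ∈ H²(S, ∂S; ℤ)` is the Euler class of `ρ` relative to the lifts `γ j` of the images of the
boundary components: the class of an obstruction cochain. -/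
def IsRelEulerClass {g n : ℕ} (ρ : SurfaceGroup g n →* PSL) (γ : Fin n → PSLTilde)
    (E : RelCohomology₂ g n) : Prop :=
  ∃ o : Face → ℤ, IsObstructionCochain ρ γ o ∧ E = QuotientAddGroup.mk o

end MilnorWood

end

noncomputable section

namespace MilnorWood

open Complex (arg slitPlane)

/-! ## Arguments along paths -/

theorem eq_zero_of_coe_eq_zero_of_abs_lt {x : ℝ} (h : (x : Real.Angle) = 0)
    (hx : |x| < 2 * Real.pi) : x = 0 := by
  obtain ⟨k, hk⟩ := Real.Angle.coe_eq_zero_iff.mp h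
  have hpi := Real.pi_pos
  rw [zsmul_eq_mul] at hk
  rw [← hk, abs_mul, abs_of_pos (by positivity : (0 : ℝ) < 2 * Real.pi)] at hx
  have : |(k : ℝ)| < 1 := by nlinarith
  have hk0 : k = 0 := Int.abs_lt_one_iff.mp (by exact_mod_cast this)
  rw [← hk, hk0]; simp

theorem isCoveringMap_angle : IsCoveringMap ((↑) : ℝ → Real.Angle) :=
  AddCircle.isCoveringMap_coe (2 * Real.pi)

theorem eq_of_coe_angle_eq {u v : I → ℝ} (hu : Continuous u) (hv : Continuous v)
    (h : ∀ t, (u t : Real.Angle) = v t) (h0 : u 0 = v 0) (t : I) : u t = v t :=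
  congrFun (isCoveringMap_angle.eq_of_comp_eq hu hv (funext h) 0 h0) t

/-! ## The Möbius action and angles between points of the hyperbolic plane -/

theorem den_re (A : SL(2, ℝ)) (z : ℍ) : (den A z).re = A 1 0 * z.re + A 1 1 := by
  simp [den]

theorem den_im (A : SL(2, ℝ)) (z : ℍ) : (den A z).im = A 1 0 * z.im := by
  simp [den]

theorem den_one (z : ℍ) : den 1 z = 1 := by simp [den]

theorem den_neg (A : SL(2, ℝ)) (z : ℍ) : den (-A) z = -den A z := by
  simp [den]; ring

theorem continuous_entry (i j : Fin 2) : Continuous fun A : SL(2, ℝ) => A i j :=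
  (continuous_apply_apply i j).comp continuous_subtype_val

theorem continuous_den (z : ℍ) : Continuous fun A : SL(2, ℝ) => den A z := by
  have := continuous_entry 1 0
  have := continuous_entry 1 1
  unfold den
  fun_prop

theorem continuous_coe_smul (z : ℍ) : Continuous fun A : SL(2, ℝ) => ((A • z : ℍ) : ℂ) := by
  have := continuous_entry 0 0
  have := continuous_entry 0 1
  simp only [coe_smul]
  refine Continuous.div (by fun_prop) (continuous_den z) fun A => den_ne_zero A z

theorem den_div_den_mem_slitPlane (A : SL(2, ℝ)) (y w : ℍ) : den A w / den A y ∈ slitPlane := by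
  rw [Complex.mem_slitPlane_iff_not_le_zero]
  intro h
  have hy := den_ne_zero A y
  set r := den A w / den A y with hr
  have e : den A w = r * den A y := by rw [hr]; field_simp
  obtain ⟨h1, h2⟩ := Complex.le_def.mp h
  simp only [Complex.zero_re, Complex.zero_im] at h1 h2
  have ei := congrArg Complex.im e
  have er := congrArg Complex.re e
  rw [Complex.mul_im, h2, den_im, den_im] at ei
  rw [Complex.mul_re, h2, den_re, den_re] at er
  have c0 : A 1 0 = 0 := by
    have : A 1 0 * (w.im - r.re * y.im) = 0 := by linarith
    rcases mul_eq_zero.mp this with h | h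
    · exact h
    · nlinarith [w.im_pos, y.im_pos]
  rw [c0] at er
  have d0 : A 1 1 ≠ 0 := fun d0 => by simp [den, c0, d0] at hy
  have : r.re = 1 := by
    have : (r.re - 1) * A 1 1 = 0 := by linarith
    rcases mul_eq_zero.mp this with h | h
    · linarith
    · exact absurd h d0
  linarith

/-- The continuous choice of the increment of the argument of `c z + d` from `y` to `w`. -/
def denTurn (A : SL(2, ℝ)) (y w : ℍ) : ℝ := arg (den A w / den A y)

theorem coe_denTurn (A : SL(2, ℝ)) (y w : ℍ) :
    (denTurn A y w : Real.Angle) = (arg (den A w) : Real.Angle) - arg (den A y) :=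
  Complex.arg_div_coe_angle (den_ne_zero _ _) (den_ne_zero _ _)

theorem abs_denTurn_lt (A : SL(2, ℝ)) (y w : ℍ) : |denTurn A y w| < Real.pi :=
  (Complex.abs_arg_le_pi _).lt_of_ne fun h => by
    have h' := (Complex.mem_slitPlane_iff_arg.mp (den_div_den_mem_slitPlane A y w)).1
    rcases abs_eq Real.pi_pos.le |>.mp h with h | h
    · exact h' h
    · linarith [Complex.neg_pi_lt_arg (den A w / den A y)]

theorem continuous_denTurn (y w : ℍ) : Continuous fun A : SL(2, ℝ) => denTurn A y w := by
  refine continuous_iff_continuousAt.mpr fun A => ?_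
  refine ContinuousAt.comp (f := fun A : SL(2, ℝ) => den A w / den A y)
    (Complex.continuousAt_arg (den_div_den_mem_slitPlane A y w)) ?_
  exact ((continuous_den w).div (continuous_den y) fun A => den_ne_zero A y).continuousAt

theorem denTurn_one (y w : ℍ) : denTurn 1 y w = 0 := by simp [denTurn, den_one]

theorem denTurn_self (A : SL(2, ℝ)) (y : ℍ) : denTurn A y y = 0 := by
  simp [denTurn, den_ne_zero]

theorem denTurn_neg (A : SL(2, ℝ)) (y w : ℍ) : denTurn (-A) y w = denTurn A y w := by
  simp [denTurn, den_neg, neg_div_neg_eq]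

/-- The function `(w - ū) / i` of two points of the upper half-plane, whose argument measures half
of the parallel translation along the geodesic from `u` to `w`. -/
def kern (u w : ℍ) : ℂ := -Complex.I * ((w : ℂ) - starRingEnd ℂ u)

theorem kern_re (u w : ℍ) : (kern u w).re = w.im + u.im := by simp [kern]

theorem kern_im (u w : ℍ) : (kern u w).im = u.re - w.re := by simp [kern]

theorem kern_re_pos (u w : ℍ) : 0 < (kern u w).re := by
  rw [kern_re]; linarith [u.im_pos, w.im_pos]

theorem kern_ne_zero (u w : ℍ) : kern u w ≠ 0 := fun h => by
  have := kern_re_pos u w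
  rw [h] at this
  simp at this

theorem kern_smul (A : SL(2, ℝ)) (u w : ℍ) :
    kern (A • u) (A • w) * (den A w * starRingEnd ℂ (den A u)) = kern u w := by
  have hu : starRingEnd ℂ (den A u) ≠ 0 := (map_ne_zero _).mpr (den_ne_zero A u)
  have hw := den_ne_zero A w
  have hd : (A 0 0 : ℂ) * A 1 1 - A 0 1 * A 1 0 = 1 := by
    have := A.det_coe
    rw [Matrix.det_fin_two] at this
    exact_mod_cast this
  unfold kern
  rw [coe_smul, coe_smul, map_div₀]
  field_simp
  simp only [den, map_add, map_mul, Complex.conj_ofReal]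
  linear_combination (-(w : ℂ) + starRingEnd ℂ u) * hd

/-- Half of the angle of parallel translation along the geodesic from `u` to `w`. -/
def shift (u w : ℍ) : ℝ := arg (kern u w)

theorem abs_shift_lt (u w : ℍ) : |shift u w| < Real.pi / 2 :=
  Complex.abs_arg_lt_pi_div_two_iff.mpr (Or.inl (kern_re_pos u w))

theorem shift_self (u : ℍ) : shift u u = 0 :=
  Complex.arg_eq_zero_iff.mpr ⟨(kern_re_pos u u).le, by rw [kern_im, sub_self]⟩

theorem shift_comm (u w : ℍ) : shift w u = -shift u w := by
  have h : kern w u = starRingEnd ℂ (kern u w) := by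
    apply Complex.ext <;> simp [kern_re, kern_im, add_comm]
  rw [shift, shift, h, Complex.arg_conj, if_neg]
  have := abs_lt.mp (abs_shift_lt u w)
  rw [shift] at this
  linarith [Real.pi_pos]

theorem shift_smul (A : SL(2, ℝ)) (u w : ℍ) :
    shift (A • u) (A • w) = shift u w - denTurn A u w := by
  rw [← sub_eq_zero]
  have hu := den_ne_zero A u
  have hw := den_ne_zero A w
  refine eq_zero_of_coe_eq_zero_of_abs_lt ?_ ?_
  · rw [Real.Angle.coe_sub, Real.Angle.coe_sub, coe_denTurn]
    simp only [shift]
    rw [← kern_smul A u w, Complex.arg_mul_coe_angle (kern_ne_zero _ _) (mul_ne_zero hw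
      ((map_ne_zero _).mpr hu)), Complex.arg_mul_coe_angle hw ((map_ne_zero _).mpr hu),
      Complex.arg_conj_coe_angle]
    abel
  · have h1 := abs_lt.mp (abs_shift_lt (A • u) (A • w))
    have h2 := abs_lt.mp (abs_shift_lt u w)
    have h3 := abs_lt.mp (abs_denTurn_lt A u w)
    rw [abs_lt]
    constructor <;> linarith

/-- The area of a geodesic triangle is less than `π`. -/
theorem abs_shift_triangle_lt (u v w : ℍ) :
    |shift u v + shift v w + shift w u| < Real.pi / 2 := by
  set S := shift u v + shift v w + shift w u with hS
  set P := kern u v * kern v w * kern w u with hP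
  have hP0 : P ≠ 0 := mul_ne_zero (mul_ne_zero (kern_ne_zero _ _) (kern_ne_zero _ _))
    (kern_ne_zero _ _)
  have hre : 0 < P.re := by
    have hu := u.im_pos
    have hv := v.im_pos
    have hw := w.im_pos
    have e : P.re = (v.im + u.im) * (w.im + v.im) * (u.im + w.im) +
        u.im * (v.re - w.re) ^ 2 + v.im * (w.re - u.re) ^ 2 + w.im * (u.re - v.re) ^ 2 := by
      simp only [hP, Complex.mul_re, Complex.mul_im, kern_re, kern_im]
      ring
    rw [e]
    positivity
  have hang : (S : Real.Angle) = arg P := by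
    rw [hS, hP, Complex.arg_mul_coe_angle (mul_ne_zero (kern_ne_zero _ _) (kern_ne_zero _ _))
      (kern_ne_zero _ _), Complex.arg_mul_coe_angle (kern_ne_zero _ _) (kern_ne_zero _ _)]
    simp [shift]
  have hargP := Complex.abs_arg_lt_pi_div_two_iff.mpr (Or.inl hre)
  have hz : S - arg P = 0 := by
    refine eq_zero_of_coe_eq_zero_of_abs_lt (by rw [Real.Angle.coe_sub, hang, sub_self]) ?_
    have h1 := abs_lt.mp (abs_shift_lt u v)
    have h2 := abs_lt.mp (abs_shift_lt v w)
    have h3 := abs_lt.mp (abs_shift_lt w u)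
    have h4 := abs_lt.mp hargP
    rw [abs_lt]
    constructor <;> linarith
  rw [sub_eq_zero.mp hz]
  exact hargP

/-! ## `PSL₂ℝ` and its action -/

theorem mk_neg (A : SL(2, ℝ)) : (QuotientGroup.mk (-A) : PSL) = QuotientGroup.mk A := by
  refine QuotientGroup.eq.mpr (Matrix.SpecialLinearGroup.mem_center_iff.mpr ⟨-1, by simp, ?_⟩)
  have : (-A)⁻¹ * A = -1 := by rw [inv_neg, neg_mul, inv_mul_cancel]
  rw [this]
  ext i j
  fin_cases i <;> fin_cases j <;> simp

theorem mk_eq_mk_iff {A B : SL(2, ℝ)} :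
    (QuotientGroup.mk A : PSL) = QuotientGroup.mk B ↔ A = B ∨ A = -B := by
  refine ⟨fun h => ?_, ?_⟩
  · obtain ⟨r, hr, h⟩ := Matrix.SpecialLinearGroup.mem_center_iff.mp (QuotientGroup.eq.mp h)
    have hr2 : r ^ 2 = 1 := by simpa using hr
    have hB : (B : Matrix (Fin 2) (Fin 2) ℝ) = r • (A : Matrix (Fin 2) (Fin 2) ℝ) := by
      have : B = A * (A⁻¹ * B) := by group
      rw [this, Matrix.SpecialLinearGroup.coe_mul, ← h]
      simp [Matrix.smul_eq_mul_diagonal]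
    rcases (by simpa using hr2 : r = 1 ∨ r = -1) with rfl | rfl
    · left
      exact Subtype.ext (by rw [hB, one_smul])
    · right
      exact Subtype.ext (by
        rw [Matrix.SpecialLinearGroup.coe_neg, hB, neg_smul, one_smul, neg_neg])
  · rintro (rfl | rfl)
    · rfl
    · exact mk_neg B

/-- The unit tangent vector at `y` with the direction of the positive real axis. -/
def frame (y : ℍ) : UnitTangent := ⟨y, (y.im : ℂ), by simp [abs_of_pos y.im_pos]⟩

/-- The action of `PSL₂ℝ` on the hyperbolic plane. -/
def act (g : PSL) (y : ℍ) : ℍ := (g • frame y).base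

theorem act_mk (A : SL(2, ℝ)) (y : ℍ) : act (QuotientGroup.mk A) y = A • y := rfl

/-- The angle through which the differential of an isometry turns the tangent vectors at `i`. -/
def frameAngle (g : PSL) : Real.Angle := (arg (g • frame UpperHalfPlane.I).vec : Real.Angle)

theorem frameAngle_mk (A : SL(2, ℝ)) :
    frameAngle (QuotientGroup.mk A) = -((2 : ℕ) • (arg (den A UpperHalfPlane.I) : Real.Angle)) := by
  rw [frameAngle, mk_smul, smul_vec]
  have : (frame UpperHalfPlane.I).vec = 1 := by simp [frame]
  rw [this, one_div, Complex.arg_inv_coe_angle, Complex.arg_pow_coe_angle]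
  rfl

theorem continuous_of_continuous_mk {X : Type*} [TopologicalSpace X] {F : PSL → X}
    (h : Continuous fun A : SL(2, ℝ) => F (QuotientGroup.mk A)) : Continuous F :=
  (QuotientGroup.isQuotientMap_mk (N := Subgroup.center SL(2, ℝ))).continuous_iff.mpr h

theorem continuous_coe_act (y : ℍ) : Continuous fun g : PSL => ((act g y : ℍ) : ℂ) :=
  continuous_of_continuous_mk (continuous_coe_smul y)

theorem continuous_coe_arg_den (y : ℍ) :
    Continuous fun A : SL(2, ℝ) => (arg (den A y) : Real.Angle) :=
  continuous_iff_continuousAt.mpr fun A =>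
    ContinuousAt.comp (f := fun A : SL(2, ℝ) => den A y) (g := fun z => (arg z : Real.Angle))
      (Complex.continuousAt_arg_coe_angle (den_ne_zero A y)) (continuous_den y).continuousAt

theorem continuous_frameAngle : Continuous frameAngle := by
  refine continuous_of_continuous_mk ?_
  simp only [frameAngle_mk]
  simp only [two_nsmul]
  exact ((continuous_coe_arg_den _).add (continuous_coe_arg_den _)).neg

theorem norm_den_eq {A B : SL(2, ℝ)} {y : ℍ} (h : A • y = B • y) : ‖den A y‖ = ‖den B y‖ := by
  have e : (A • y).im = (B • y).im := by rw [h]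
  rw [im_smul, im_smul] at e
  have hA := norm_pos_iff.mpr (den_ne_zero A y)
  have hB := norm_pos_iff.mpr (den_ne_zero B y)
  have := y.im_pos
  rw [div_eq_div_iff (by positivity) (by positivity)] at e
  exact ((sq_eq_sq₀ hA.le hB.le).mp (mul_left_cancel₀ this.ne' e.symm))

theorem eq_of_smul_eq_of_den_eq {A B : SL(2, ℝ)} {y : ℍ} (h : A • y = B • y)
    (hd : den A y = den B y) : A = B := by
  have hy := y.im_pos
  have e : ((A • y : ℍ) : ℂ) = ((B • y : ℍ) : ℂ) := by rw [h]
  rw [coe_smul, coe_smul, hd, div_left_inj' (den_ne_zero B y)] at e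
  have key : ∀ a b c d : ℝ, (a : ℂ) * y + b = (c : ℂ) * y + d → a = c ∧ b = d := by
    intro a b c d h
    have hi := congrArg Complex.im h
    have hr := congrArg Complex.re h
    simp at hi hr
    have : a = c := by rcases hi with h | h <;> [exact h; linarith]
    subst this
    exact ⟨rfl, by linarith⟩
  obtain ⟨h1, h2⟩ := key _ _ _ _ e
  obtain ⟨h3, h4⟩ := key _ _ _ _ hd
  ext i j
  fin_cases i <;> fin_cases j <;> assumption

theorem neg_smul_upper (A : SL(2, ℝ)) (y : ℍ) : (-A) • y = A • y := by
  rw [← act_mk, mk_neg, act_mk]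

theorem eq_of_act_eq_of_frameAngle_eq {g h : PSL}
    (hact : act g UpperHalfPlane.I = act h UpperHalfPlane.I) (hang : frameAngle g = frameAngle h) :
    g = h := by
  obtain ⟨A, rfl⟩ := QuotientGroup.mk_surjective g
  obtain ⟨B, rfl⟩ := QuotientGroup.mk_surjective h
  rw [act_mk, act_mk] at hact
  rw [frameAngle_mk, frameAngle_mk, neg_inj, Real.Angle.two_nsmul_eq_iff] at hang
  refine mk_eq_mk_iff.mpr ?_
  rcases hang with h | h
  · left
    refine eq_of_smul_eq_of_den_eq hact (Complex.ext_norm_arg (norm_den_eq hact) ?_)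
    exact (Complex.arg_coe_angle_eq_iff).mp h
  · right
    rw [← neg_smul_upper B] at hact
    refine eq_of_smul_eq_of_den_eq hact (Complex.ext_norm_arg (norm_den_eq hact) ?_)
    rw [← Complex.arg_neg_coe_angle (den_ne_zero B _), ← den_neg] at h
    exact (Complex.arg_coe_angle_eq_iff).mp h

/-! ## The Iwasawa parametrization -/

/-- The upper triangular matrix with `i ↦ x + i e^u`. -/
def upperMatrix (x u : ℝ) : SL(2, ℝ) :=
  ⟨!![Real.exp (u / 2), x * Real.exp (-(u / 2)); 0, Real.exp (-(u / 2))], by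
    rw [Matrix.det_fin_two_of, ← Real.exp_add]; simp⟩

/-- The map `ℝ³ → SL₂ℝ` given by the Iwasawa decomposition. -/
def iwasawa (p : ℝ × ℝ × ℝ) : SL(2, ℝ) := upperMatrix p.1 p.2.1 * rotMatrix p.2.2

theorem continuous_iwasawa : Continuous iwasawa := by
  refine Continuous.mul ?_ (continuous_rotMatrix.comp (by fun_prop))
  refine Continuous.subtype_mk ?_ _
  refine continuous_matrix fun i j => ?_
  fin_cases i <;> fin_cases j <;> simp <;> fun_prop

theorem den_rotMatrix (s : ℝ) :
    den (rotMatrix s) UpperHalfPlane.I = Complex.exp (↑(-s) * Complex.I) := by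
  rw [Complex.exp_mul_I]
  simp [den, rotMatrix, add_comm]

theorem rotMatrix_smul_I (s : ℝ) : rotMatrix s • UpperHalfPlane.I = UpperHalfPlane.I := by
  apply UpperHalfPlane.ext
  rw [coe_smul, div_eq_iff (den_ne_zero _ _)]
  simp [den, rotMatrix]
  linear_combination (Complex.sin s) * Complex.I_sq

theorem rotMatrix_zero : rotMatrix 0 = 1 := by
  ext i j
  fin_cases i <;> fin_cases j <;> simp [rotMatrix]

theorem den_iwasawa (p : ℝ × ℝ × ℝ) : den (iwasawa p) UpperHalfPlane.I =
    (Real.exp (-(p.2.1 / 2)) : ℝ) * Complex.exp (↑(-p.2.2) * Complex.I) := by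
  rw [iwasawa, den_mul, den_rotMatrix, rotMatrix_smul_I]
  simp [den, upperMatrix]

theorem iwasawa_smul_I (p : ℝ × ℝ × ℝ) :
    ((iwasawa p • UpperHalfPlane.I : ℍ) : ℂ) = p.1 + Real.exp p.2.1 * Complex.I := by
  rw [iwasawa, mul_smul, rotMatrix_smul_I, coe_smul, div_eq_iff (den_ne_zero _ _)]
  simp only [den, upperMatrix]
  have : Real.exp (p.2.1 / 2) = Real.exp p.2.1 * Real.exp (-(p.2.1 / 2)) := by
    rw [← Real.exp_add]; ring_nf
  simp [-Complex.ofReal_exp, this]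
  ring

theorem iwasawa_zero : iwasawa 0 = 1 := by
  have : upperMatrix 0 0 = 1 := by
    ext i j
    fin_cases i <;> fin_cases j <;> simp [upperMatrix]
  simp [iwasawa, this, rotMatrix_zero]

theorem coe_arg_exp (r : ℝ) (hr : 0 < r) (s : ℝ) :
    (arg (r * Complex.exp (s * Complex.I)) : Real.Angle) = s := by
  rw [Complex.exp_mul_I, ← Complex.ofReal_cos, ← Complex.ofReal_sin]
  exact Complex.arg_mul_cos_add_sin_mul_I_coe_angle hr s

theorem coe_arg_den_iwasawa (p : ℝ × ℝ × ℝ) :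
    (arg (den (iwasawa p) UpperHalfPlane.I) : Real.Angle) = -(p.2.2 : Real.Angle) := by
  rw [den_iwasawa, coe_arg_exp _ (Real.exp_pos _), Real.Angle.coe_neg]

/-- The Iwasawa coordinates of an isometry, with a choice `ψ` of the angle. -/
def coords (g : PSL) (ψ : ℝ) : ℝ × ℝ × ℝ :=
  ((act g UpperHalfPlane.I).re, Real.log (act g UpperHalfPlane.I).im, ψ)

theorem mk_iwasawa_coords {g : PSL} {ψ : ℝ} (h : frameAngle g = ((2 * ψ : ℝ) : Real.Angle)) :
    (QuotientGroup.mk (iwasawa (coords g ψ)) : PSL) = g := by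
  refine eq_of_act_eq_of_frameAngle_eq ?_ ?_
  · apply UpperHalfPlane.ext
    rw [act_mk, iwasawa_smul_I, coords, Real.exp_log (UpperHalfPlane.im_pos _)]
    apply Complex.ext <;> simp
  · rw [frameAngle_mk, coe_arg_den_iwasawa, h, two_mul, Real.Angle.coe_add, two_nsmul]
    simp [coords]

/-! ## The angle coordinate on the universal covering group -/

theorem frameAngle_one : frameAngle 1 = 0 := by
  have : (1 : PSL) = QuotientGroup.mk 1 := rfl
  rw [this, frameAngle_mk, den_one]
  simp

/-- The path of the angles `frameAngle`. -/
def anglePath (f : C(I, PSL)) : C(I, Real.Angle) := ⟨_, continuous_frameAngle.comp f.continuous⟩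

theorem anglePath_zero (f : BasedPath) : anglePath f 0 = ((0 : ℝ) : Real.Angle) := by
  change frameAngle ((f : C(I, PSL)) 0) = _
  rw [f.2, frameAngle_one, Real.Angle.coe_zero]

/-- The continuous choice of the angle along a path. -/
def angleLift (f : BasedPath) : C(I, ℝ) :=
  isCoveringMap_angle.liftPath (anglePath f) 0 (anglePath_zero f)

theorem coe_angleLift (f : BasedPath) (t : I) :
    (angleLift f t : Real.Angle) = frameAngle ((f : C(I, PSL)) t) :=
  congrFun (isCoveringMap_angle.liftPath_lifts (anglePath f) 0 (anglePath_zero f)) t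

theorem angleLift_zero (f : BasedPath) : angleLift f 0 = 0 :=
  isCoveringMap_angle.liftPath_zero (anglePath f) 0 (anglePath_zero f)

theorem anglePath_homotopicRel {f g : C(I, PSL)} (h : f.HomotopicRel g {0, 1}) :
    (anglePath f).HomotopicRel (anglePath g) {0, 1} :=
  h.comp_continuousMap ⟨_, continuous_frameAngle⟩

/-- Half of the total angle through which a path of isometries turns the tangent vectors at `i`. -/
def halfAngle : PSLTilde → ℝ :=
  Quotient.lift (fun f : BasedPath => angleLift f 1 / 2) fun f g h => by
    have := isCoveringMap_angle.liftPath_apply_one_eq_of_homotopicRel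
      (anglePath_homotopicRel h) 0 (anglePath_zero f) (anglePath_zero g)
    change angleLift f 1 / 2 = angleLift g 1 / 2
    rw [angleLift, angleLift, this]

/-- The class of a path of matrices. -/
def cls (A : C(I, SL(2, ℝ))) (hA : A 0 = 1) : PSLTilde :=
  ((⟨⟨fun t => QuotientGroup.mk (A t), continuous_quot_mk.comp A.continuous⟩, by
    change (QuotientGroup.mk (A 0) : PSL) = 1
    rw [hA]; rfl⟩ : BasedPath) : pathHomotopy.Quotient)

theorem proj_cls (A : C(I, SL(2, ℝ))) (hA : A 0 = 1) : proj (cls A hA) = QuotientGroup.mk (A 1) :=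
  rfl

theorem halfAngle_coe_eq (f : BasedPath) {A : I → SL(2, ℝ)}
    (hA : ∀ t, (f : C(I, PSL)) t = QuotientGroup.mk (A t)) {ψ : I → ℝ} (hψ : Continuous ψ)
    (h0 : ψ 0 = 0)
    (h : ∀ t, (arg (den (A t) UpperHalfPlane.I) : Real.Angle) = -(ψ t : Real.Angle)) :
    halfAngle (f : pathHomotopy.Quotient) = ψ 1 := by
  have := eq_of_coe_angle_eq (u := angleLift f) (v := fun t => 2 * ψ t) (angleLift f).continuous
    (by fun_prop) (fun t => by
      rw [coe_angleLift, hA, frameAngle_mk, h, two_mul, Real.Angle.coe_add, two_nsmul]; abel)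
    (by rw [angleLift_zero, h0, mul_zero]) 1
  change angleLift f 1 / 2 = ψ 1
  rw [this]; ring

theorem halfAngle_cls {A : C(I, SL(2, ℝ))} {hA : A 0 = 1} {ψ : I → ℝ} (hψ : Continuous ψ)
    (h0 : ψ 0 = 0)
    (h : ∀ t, (arg (den (A t) UpperHalfPlane.I) : Real.Angle) = -(ψ t : Real.Angle)) :
    halfAngle (cls A hA) = ψ 1 :=
  halfAngle_coe_eq _ (fun _ => rfl) hψ h0 h

/-- The path of Iwasawa coordinates of a path of isometries. -/
def coordsPath (f : BasedPath) : C(I, ℝ × ℝ × ℝ) :=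
  ⟨fun t => coords ((f : C(I, PSL)) t) (angleLift f t / 2), by
    have h := (continuous_coe_act UpperHalfPlane.I).comp (f : C(I, PSL)).continuous
    have hre := Complex.continuous_re.comp h
    have him := Complex.continuous_im.comp h
    refine Continuous.prodMk hre (Continuous.prodMk ?_ (by fun_prop))
    exact him.log fun t => (UpperHalfPlane.im_pos _).ne'⟩

theorem mk_iwasawa_coordsPath (f : BasedPath) (t : I) :
    (QuotientGroup.mk (iwasawa (coordsPath f t)) : PSL) = (f : C(I, PSL)) t :=
  mk_iwasawa_coords (by rw [← coe_angleLift]; congr 1; ring)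

theorem coordsPath_zero (f : BasedPath) : coordsPath f 0 = 0 := by
  change coords ((f : C(I, PSL)) 0) (angleLift f 0 / 2) = 0
  have : (1 : PSL) = QuotientGroup.mk 1 := rfl
  rw [f.2, angleLift_zero, coords, this, act_mk, one_smul]
  simp

/-- Every path of isometries lifts to a path of matrices, along which the argument of `den` has a
continuous choice. -/
theorem exists_matrix_path (f : BasedPath) : ∃ (A : C(I, SL(2, ℝ))) (ψ : C(I, ℝ)),
    A 0 = 1 ∧ (∀ t, (f : C(I, PSL)) t = QuotientGroup.mk (A t)) ∧ ψ 0 = 0 ∧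
      ψ 1 = halfAngle (f : pathHomotopy.Quotient) ∧
      ∀ t, (arg (den (A t) UpperHalfPlane.I) : Real.Angle) = -(ψ t : Real.Angle) := by
  refine ⟨⟨_, continuous_iwasawa.comp (coordsPath f).continuous⟩,
    ⟨fun t => angleLift f t / 2, by fun_prop⟩, ?_, fun t => (mk_iwasawa_coordsPath f t).symm, ?_,
    rfl, fun t => coe_arg_den_iwasawa _⟩
  · change iwasawa (coordsPath f 0) = 1
    rw [coordsPath_zero, iwasawa_zero]
  · change angleLift f 0 / 2 = 0
    rw [angleLift_zero, zero_div]

theorem exists_eq_cls (a : PSLTilde) : ∃ (A : C(I, SL(2, ℝ))) (hA : A 0 = 1) (ψ : C(I, ℝ)),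
    a = cls A hA ∧ ψ 0 = 0 ∧ ψ 1 = halfAngle a ∧
      ∀ t, (arg (den (A t) UpperHalfPlane.I) : Real.Angle) = -(ψ t : Real.Angle) := by
  obtain ⟨f, rfl⟩ := Quotient.exists_rep a
  obtain ⟨A, ψ, hA, hf, h⟩ := exists_matrix_path f
  exact ⟨A, hA, ψ, congrArg (Quotient.mk _) (Subtype.ext (ContinuousMap.ext hf)), h⟩

theorem eq_of_proj_eq_of_halfAngle_eq {a b : PSLTilde} (hp : proj a = proj b)
    (hs : halfAngle a = halfAngle b) : a = b := by
  obtain ⟨f, rfl⟩ := Quotient.exists_rep a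
  obtain ⟨g, rfl⟩ := Quotient.exists_rep b
  refine Quotient.sound ?_
  change (f : C(I, PSL)).HomotopicRel g {0, 1}
  have h1 : coordsPath f 1 = coordsPath g 1 := by
    change coords ((f : C(I, PSL)) 1) (angleLift f 1 / 2) =
      coords ((g : C(I, PSL)) 1) (angleLift g 1 / 2)
    have hp' : (f : C(I, PSL)) 1 = (g : C(I, PSL)) 1 := hp
    have hs' : angleLift f 1 / 2 = angleLift g 1 / 2 := hs
    rw [hp', hs']
  have hh : (coordsPath f).HomotopicRel (coordsPath g) {0, 1} := by
    refine ⟨⟨ContinuousMap.Homotopy.affine _ _, fun t x hx => ?_⟩⟩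
    have : coordsPath f x = coordsPath g x := by
      rcases hx with rfl | rfl
      · rw [coordsPath_zero, coordsPath_zero]
      · exact h1
    change ContinuousMap.Homotopy.affine (coordsPath f) (coordsPath g) (t, x) = coordsPath f x
    simp [this]
  have := hh.comp_continuousMap
    (⟨fun p => QuotientGroup.mk (iwasawa p), continuous_quot_mk.comp continuous_iwasawa⟩ :
      C(ℝ × ℝ × ℝ, PSL))
  convert this using 1
  · exact ContinuousMap.ext fun t => (mk_iwasawa_coordsPath f t).symm
  · exact ContinuousMap.ext fun t => (mk_iwasawa_coordsPath g t).symm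

theorem cls_mul (A B : C(I, SL(2, ℝ))) (hA : A 0 = 1) (hB : B 0 = 1) :
    cls A hA * cls B hB = cls (A * B) (by rw [ContinuousMap.mul_apply, hA, hB, one_mul]) := rfl

theorem halfAngle_mul {a b : PSLTilde} {A B : SL(2, ℝ)} (hA : proj a = QuotientGroup.mk A)
    (hB : proj b = QuotientGroup.mk B) : halfAngle (a * b) =
      halfAngle a + halfAngle b - denTurn A UpperHalfPlane.I (B • UpperHalfPlane.I) := by
  obtain ⟨A', hA', φ, rfl, hφ, hφ1, hargA⟩ := exists_eq_cls a
  obtain ⟨B', hB', ψ, rfl, hψ, hψ1, hargB⟩ := exists_eq_cls b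
  have hc : Continuous fun t : I => denTurn (A' t) UpperHalfPlane.I (B' t • UpperHalfPlane.I) := by
    refine continuous_iff_continuousAt.mpr fun t => ?_
    refine ContinuousAt.comp (f := fun t : I => den (A' t) (B' t • UpperHalfPlane.I) /
      den (A' t) UpperHalfPlane.I)
      (Complex.continuousAt_arg (den_div_den_mem_slitPlane _ _ _)) ?_
    refine ContinuousAt.div ?_ ((continuous_den _).comp A'.continuous).continuousAt
      (den_ne_zero _ _)
    have h1 := (continuous_entry 1 0).comp A'.continuous
    have h2 := (continuous_entry 1 1).comp A'.continuous
    have h3 := (continuous_coe_smul UpperHalfPlane.I).comp B'.continuous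
    exact (((Complex.continuous_ofReal.comp h1).mul h3).add
      (Complex.continuous_ofReal.comp h2)).continuousAt
  rw [cls_mul, ← hφ1, ← hψ1]
  rw [proj_cls] at hA hB
  have e : halfAngle (cls (A' * B') (by rw [ContinuousMap.mul_apply, hA', hB', one_mul])) =
      φ 1 + ψ 1 - denTurn (A' 1) UpperHalfPlane.I (B' 1 • UpperHalfPlane.I) := by
    refine halfAngle_cls (ψ := fun t => φ t + ψ t -
      denTurn (A' t) UpperHalfPlane.I (B' t • UpperHalfPlane.I)) (by fun_prop) ?_ fun t => ?_
    · simp [hφ, hψ, hA', denTurn_one]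
    · rw [ContinuousMap.mul_apply, den_mul, Complex.arg_mul_coe_angle (den_ne_zero _ _)
        (den_ne_zero _ _), Real.Angle.coe_sub, Real.Angle.coe_add, coe_denTurn, hargA, hargB]
      abel
  rw [e]
  congr 1
  have hBI : B' 1 • UpperHalfPlane.I = B • UpperHalfPlane.I := by rw [← act_mk, hB, act_mk]
  rw [hBI]
  rcases mk_eq_mk_iff.mp hA with h | h
  · rw [h]
  · rw [h, denTurn_neg]

/-! ## Lifts of the identity -/

theorem halfAngle_one : halfAngle 1 = 0 := by
  have h := halfAngle_mul (a := 1) (b := 1) (A := 1) (B := 1) rfl rfl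
  rw [one_mul, denTurn_one] at h
  linarith

theorem coe_two_mul_halfAngle (a : PSLTilde) :
    ((2 * halfAngle a : ℝ) : Real.Angle) = frameAngle (proj a) := by
  obtain ⟨f, rfl⟩ := Quotient.exists_rep a
  rw [show 2 * halfAngle (Quotient.mk _ f) = angleLift f 1 by
    change 2 * (angleLift f 1 / 2) = _; ring]
  exact coe_angleLift f 1

theorem proj_zeta : proj zeta = 1 := by
  change (QuotientGroup.mk (rotMatrix (Real.pi * ((1 : I) : ℝ))) : PSL) = QuotientGroup.mk 1
  refine mk_eq_mk_iff.mpr (Or.inr ?_)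
  ext i j
  fin_cases i <;> fin_cases j <;> simp [rotMatrix]

theorem coe_arg_den_rotMatrix (s : ℝ) :
    (arg (den (rotMatrix s) UpperHalfPlane.I) : Real.Angle) = -(s : Real.Angle) := by
  have h := coe_arg_exp 1 one_pos (-s)
  rwa [Complex.ofReal_one, one_mul, ← den_rotMatrix, Real.Angle.coe_neg] at h

theorem halfAngle_zeta : halfAngle zeta = Real.pi := by
  have := halfAngle_coe_eq fullTurn (A := fun t => rotMatrix (Real.pi * t)) (fun _ => rfl)
    (ψ := fun t => Real.pi * t) (by fun_prop) (by simp) (fun t => coe_arg_den_rotMatrix _)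
  rw [zeta, this]
  simp

theorem halfAngle_mul_of_proj_eq_one {a b : PSLTilde} (ha : proj a = 1) :
    halfAngle (a * b) = halfAngle a + halfAngle b := by
  obtain ⟨B, hB⟩ := QuotientGroup.mk_surjective (proj b)
  rw [halfAngle_mul (A := 1) ha hB.symm, denTurn_one, sub_zero]

theorem commute_of_proj_eq_one {a : PSLTilde} (ha : proj a = 1) (b : PSLTilde) : Commute a b := by
  refine eq_of_proj_eq_of_halfAngle_eq (by simp [ha]) ?_
  obtain ⟨B, hB⟩ := QuotientGroup.mk_surjective (proj b)
  rw [halfAngle_mul_of_proj_eq_one ha, halfAngle_mul (B := 1) hB.symm ha, one_smul, denTurn_self]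
  ring

theorem proj_zeta_zpow (k : ℤ) : proj (zeta ^ k) = 1 := by rw [map_zpow, proj_zeta, one_zpow]

theorem halfAngle_zeta_zpow (k : ℤ) : halfAngle (zeta ^ k) = k * Real.pi := by
  induction k with
  | zero => simp [halfAngle_one]
  | succ k ih =>
    rw [zpow_add_one, halfAngle_mul_of_proj_eq_one (proj_zeta_zpow _), ih, halfAngle_zeta]
    push_cast; ring
  | pred k ih =>
    have h : zeta ^ (-(k : ℤ)) = zeta ^ (-(k : ℤ) - 1) * zeta := by group
    rw [h, halfAngle_mul_of_proj_eq_one (proj_zeta_zpow _), halfAngle_zeta] at ih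
    push_cast at ih ⊢
    linarith

theorem exists_eq_zeta_zpow {a : PSLTilde} (ha : proj a = 1) : ∃ k : ℤ, a = zeta ^ k := by
  have h := coe_two_mul_halfAngle a
  rw [ha, frameAngle_one] at h
  obtain ⟨k, hk⟩ := Real.Angle.coe_eq_zero_iff.mp h
  refine ⟨k, eq_of_proj_eq_of_halfAngle_eq (by rw [ha, proj_zeta_zpow]) ?_⟩
  rw [halfAngle_zeta_zpow]
  rw [zsmul_eq_mul] at hk
  linarith

theorem zeta_zpow_injective : Function.Injective fun k : ℤ => zeta ^ k := fun k l h => by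
  have h := congrArg halfAngle h
  simp only [halfAngle_zeta_zpow] at h
  exact_mod_cast mul_right_cancel₀ Real.pi_ne_zero h

theorem proj_surjective : Function.Surjective proj := fun g => by
  obtain ⟨r, hr⟩ : ∃ r : ℝ, (r : Real.Angle) = frameAngle g := ⟨_, Real.Angle.coe_toReal _⟩
  have h := mk_iwasawa_coords (g := g) (ψ := r / 2) (by rw [← hr]; congr 1; ring)
  refine ⟨cls ⟨fun t : I => iwasawa ((t : ℝ) • coords g (r / 2)),
    continuous_iwasawa.comp (by fun_prop)⟩ ?_, ?_⟩
  · change iwasawa (((0 : I) : ℝ) • coords g (r / 2)) = 1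
    simp [iwasawa_zero]
  · rw [proj_cls]
    simpa using h

/-! ## Half of the twist, in terms of the angle coordinate -/

/-- The increment of the argument of `den` from `i` to `y`. -/
def turn (g : PSL) (y : ℍ) : ℝ := denTurn (Quotient.out g) UpperHalfPlane.I y

theorem turn_mk (A : SL(2, ℝ)) (y : ℍ) :
    turn (QuotientGroup.mk A) y = denTurn A UpperHalfPlane.I y := by
  have h : (QuotientGroup.mk (Quotient.out (QuotientGroup.mk A : PSL)) : PSL) =
    QuotientGroup.mk A := Quotient.out_eq _
  rw [turn]
  rcases mk_eq_mk_iff.mp h with h | h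
  · rw [h]
  · rw [h, denTurn_neg]

/-- Half of the twist at `y`. -/
def halfTwist (a : PSLTilde) (y : ℍ) : ℝ :=
  halfAngle a - turn (proj a) y - shift y (act (proj a) y)

theorem halfTwist_eq {a : PSLTilde} {A : SL(2, ℝ)} (hA : proj a = QuotientGroup.mk A) (y : ℍ) :
    halfTwist a y = halfAngle a - denTurn A UpperHalfPlane.I y - shift y (A • y) := by
  rw [halfTwist, hA, turn_mk, act_mk]

/-- The function `den A y * kern y (A • y)`, whose argument is minus half of the twist. -/
def displacement (A : SL(2, ℝ)) (y : ℍ) : ℂ := den A y * kern y (A • y)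

theorem displacement_ne_zero (A : SL(2, ℝ)) (y : ℍ) : displacement A y ≠ 0 :=
  mul_ne_zero (den_ne_zero _ _) (kern_ne_zero _ _)

theorem displacement_eq (A : SL(2, ℝ)) (y : ℍ) : displacement A y =
    -Complex.I * ((A 0 0 : ℂ) * y + A 0 1 - starRingEnd ℂ y * ((A 1 0 : ℂ) * y + A 1 1)) := by
  have h := den_ne_zero A y
  rw [displacement, kern, coe_smul]
  field_simp
  rw [den]
  ring

theorem displacement_re (A : SL(2, ℝ)) (y : ℍ) :
    (displacement A y).re = (A 0 0 + A 1 1) * y.im := by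
  rw [displacement_eq]; simp; ring

theorem displacement_im (A : SL(2, ℝ)) (y : ℍ) : (displacement A y).im =
    A 1 0 * (y.re ^ 2 + y.im ^ 2) - (A 0 0 - A 1 1) * y.re - A 0 1 := by
  rw [displacement_eq]; simp; ring

theorem continuous_displacement (y : ℍ) : Continuous fun A : SL(2, ℝ) => displacement A y := by
  have h := continuous_coe_smul y
  have h' := continuous_den y
  unfold displacement kern
  fun_prop

theorem displacement_div_mem_slitPlane (A : SL(2, ℝ)) (p q : ℍ) :
    displacement A q / displacement A p ∈ slitPlane := by
  rw [Complex.mem_slitPlane_iff_not_le_zero]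
  intro h
  have hp := displacement_ne_zero A p
  set r := displacement A q / displacement A p with hr
  have e : displacement A q = r * displacement A p := by rw [hr]; field_simp
  obtain ⟨h1, h2⟩ := Complex.le_def.mp h
  simp only [Complex.zero_re, Complex.zero_im] at h1 h2
  have ei := congrArg Complex.im e
  have er := congrArg Complex.re e
  rw [Complex.mul_im, h2, displacement_im, displacement_im] at ei
  rw [Complex.mul_re, h2, displacement_re, displacement_re] at er
  have htr : A 1 1 = -A 0 0 := by
    have : (A 0 0 + A 1 1) * (q.im - r.re * p.im) = 0 := by linarith
    rcases mul_eq_zero.mp this with h | h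
    · linarith
    · nlinarith [q.im_pos, p.im_pos]
  have hd : A 0 0 * A 1 1 - A 0 1 * A 1 0 = 1 := by
    have := A.det_coe
    rwa [Matrix.det_fin_two] at this
  have key : ∀ y : ℍ, 0 < A 1 0 *
      (A 1 0 * (y.re ^ 2 + y.im ^ 2) - (A 0 0 - A 1 1) * y.re - A 0 1) := fun y => by
    have : A 1 0 * (A 1 0 * (y.re ^ 2 + y.im ^ 2) - (A 0 0 - A 1 1) * y.re - A 0 1) =
        (A 1 0 * y.re - A 0 0) ^ 2 + (A 1 0 * y.im) ^ 2 + 1 := by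
      rw [htr] at hd ⊢
      linear_combination hd
    rw [this]
    positivity
  have hq := key q
  rw [ei] at hq
  nlinarith [key p]

/-- The continuous choice of half of the twist along a path of matrices. -/
def halfTwistAlong (A : SL(2, ℝ)) (s : ℝ) (y : ℍ) : ℝ :=
  s - denTurn A UpperHalfPlane.I y - shift y (A • y)

theorem continuous_shift_smul (y : ℍ) : Continuous fun A : SL(2, ℝ) => shift y (A • y) := by
  refine continuous_iff_continuousAt.mpr fun A => ?_
  refine ContinuousAt.comp (f := fun A : SL(2, ℝ) => kern y (A • y))
    (Complex.continuousAt_arg (Or.inl (kern_re_pos _ _))) ?_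
  exact (continuous_const.mul ((continuous_coe_smul y).sub continuous_const)).continuousAt

theorem continuous_halfTwistAlong (A : C(I, SL(2, ℝ))) (ψ : C(I, ℝ)) (y : ℍ) :
    Continuous fun t => halfTwistAlong (A t) (ψ t) y :=
  (ψ.continuous.sub ((continuous_denTurn _ _).comp A.continuous)).sub
    ((continuous_shift_smul y).comp A.continuous)

theorem halfTwistAlong_one (y : ℍ) : halfTwistAlong 1 0 y = 0 := by
  simp [halfTwistAlong, denTurn_one, shift_self]

theorem coe_halfTwistAlong {A : SL(2, ℝ)} {s : ℝ}
    (h : (arg (den A UpperHalfPlane.I) : Real.Angle) = -(s : Real.Angle)) (y : ℍ) :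
    (halfTwistAlong A s y : Real.Angle) = -(arg (displacement A y) : Real.Angle) := by
  rw [halfTwistAlong, Real.Angle.coe_sub, Real.Angle.coe_sub, coe_denTurn, h, displacement,
    Complex.arg_mul_coe_angle (den_ne_zero _ _) (kern_ne_zero _ _), shift]
  abel

theorem norm_mul_cos_halfTwistAlong {A : SL(2, ℝ)} {s : ℝ}
    (h : (arg (den A UpperHalfPlane.I) : Real.Angle) = -(s : Real.Angle)) (y : ℍ) :
    ‖displacement A y‖ * Real.cos (halfTwistAlong A s y) = (A 0 0 + A 1 1) * y.im := by
  rw [← Real.Angle.cos_coe, coe_halfTwistAlong h, Real.Angle.cos_neg, Real.Angle.cos_coe,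
    Complex.norm_mul_cos_arg, displacement_re]

/-- Whether the twist is less than `π` does not depend on the point. -/
theorem abs_halfTwist_lt_of_abs_halfTwist_lt {a : PSLTilde} {p : ℍ}
    (hp : |halfTwist a p| < Real.pi / 2) (q : ℍ) : |halfTwist a q| < Real.pi / 2 := by
  obtain ⟨A, hA, ψ, ha, hψ, hψ1, harg⟩ := exists_eq_cls a
  have hproj : proj a = QuotientGroup.mk (A 1) := by rw [ha, proj_cls]
  have hH : ∀ y, halfTwist a y = halfTwistAlong (A 1) (ψ 1) y := fun y => by
    rw [halfTwist_eq hproj, halfTwistAlong, hψ1]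
  rw [hH] at hp ⊢
  have hdiff : halfTwistAlong (A 1) (ψ 1) q = halfTwistAlong (A 1) (ψ 1) p -
      arg (displacement (A 1) q / displacement (A 1) p) := by
    refine eq_of_coe_angle_eq (u := fun t => halfTwistAlong (A t) (ψ t) q)
      (v := fun t => halfTwistAlong (A t) (ψ t) p -
        arg (displacement (A t) q / displacement (A t) p))
      (continuous_halfTwistAlong A ψ q) ((continuous_halfTwistAlong A ψ p).sub ?_) ?_ ?_ 1
    · refine continuous_iff_continuousAt.mpr fun t => ?_
      refine ContinuousAt.comp (f := fun t => displacement (A t) q / displacement (A t) p)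
        (Complex.continuousAt_arg (displacement_div_mem_slitPlane _ _ _)) ?_
      exact (((continuous_displacement q).comp A.continuous).div
        ((continuous_displacement p).comp A.continuous)
        fun t => displacement_ne_zero _ _).continuousAt
    · intro t
      rw [Real.Angle.coe_sub, coe_halfTwistAlong (harg t), coe_halfTwistAlong (harg t),
        Complex.arg_div_coe_angle (displacement_ne_zero _ _) (displacement_ne_zero _ _)]
      abel
    · have hpos : arg (displacement 1 q / displacement 1 p) = 0 := by
        have h : ∀ y : ℍ, displacement 1 y = ((2 * y.im : ℝ) : ℂ) := fun y => by
          apply Complex.ext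
          · rw [displacement_re]
            simp only [Matrix.SpecialLinearGroup.coe_one, Matrix.one_apply_eq,
              Complex.ofReal_re]
            ring
          · rw [displacement_im]; simp
        rw [h, h, ← Complex.ofReal_div]
        have := q.im_pos
        have := p.im_pos
        exact Complex.arg_ofReal_of_nonneg (by positivity)
      simp only [hA, hψ, halfTwistAlong_one]
      rw [hpos, sub_zero]
  have hlt := (Complex.abs_arg_le_pi (displacement (A 1) q / displacement (A 1) p))
  have hcp := norm_mul_cos_halfTwistAlong (harg 1) p
  have hcq := norm_mul_cos_halfTwistAlong (harg 1) q
  have hp' := abs_lt.mp hp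
  have h1 : 0 < Real.cos (halfTwistAlong (A 1) (ψ 1) p) :=
    Real.cos_pos_of_mem_Ioo ⟨by linarith, hp'.2⟩
  have h2 : 0 < (A 1) 0 0 + (A 1) 1 1 := by
    have := mul_pos (norm_pos_iff.mpr (displacement_ne_zero (A 1) p)) h1
    rw [hcp] at this
    exact pos_of_mul_pos_left this p.im_pos.le
  have h3 : 0 < Real.cos (halfTwistAlong (A 1) (ψ 1) q) := by
    have := mul_pos h2 q.im_pos
    rw [← hcq] at this
    exact pos_of_mul_pos_right this (norm_nonneg _)
  by_contra hcon
  rw [not_lt] at hcon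
  rw [← Real.cos_abs] at h3
  have hle : |halfTwistAlong (A 1) (ψ 1) q| ≤ Real.pi + Real.pi / 2 := by
    rw [hdiff]
    exact (abs_sub _ _).trans (by linarith)
  exact absurd h3 (not_lt.mpr (Real.cos_nonpos_of_pi_div_two_le_of_le hcon hle))

/-! ## The quasimorphism -/

/-- Half of the twist at `i`. -/
def quasi (a : PSLTilde) : ℝ := halfTwist a UpperHalfPlane.I

theorem quasi_eq (a : PSLTilde) :
    quasi a = halfAngle a - shift UpperHalfPlane.I (act (proj a) UpperHalfPlane.I) := by
  obtain ⟨A, hA⟩ := QuotientGroup.mk_surjective (proj a)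
  rw [quasi, halfTwist_eq hA.symm, denTurn_self, sub_zero, ← hA, act_mk]

theorem quasi_mul (a b : PSLTilde) : quasi (a * b) = quasi a + quasi b +
    (shift UpperHalfPlane.I (act (proj a) UpperHalfPlane.I) +
      shift (act (proj a) UpperHalfPlane.I) (act (proj (a * b)) UpperHalfPlane.I) +
      shift (act (proj (a * b)) UpperHalfPlane.I) UpperHalfPlane.I) := by
  obtain ⟨A, hA⟩ := QuotientGroup.mk_surjective (proj a)
  obtain ⟨B, hB⟩ := QuotientGroup.mk_surjective (proj b)
  have hAB : proj (a * b) = QuotientGroup.mk (A * B) := by rw [map_mul, ← hA, ← hB]; rfl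
  rw [quasi_eq, quasi_eq, quasi_eq, halfAngle_mul hA.symm hB.symm, hAB, ← hA, ← hB, act_mk,
    act_mk, act_mk, mul_smul, shift_smul, shift_comm UpperHalfPlane.I]
  ring

theorem abs_quasi_mul_sub_lt (a b : PSLTilde) :
    |quasi (a * b) - quasi a - quasi b| < Real.pi / 2 := by
  rw [quasi_mul]
  have := abs_shift_triangle_lt UpperHalfPlane.I (act (proj a) UpperHalfPlane.I)
    (act (proj (a * b)) UpperHalfPlane.I)
  convert this using 2
  ring

theorem quasi_one : quasi 1 = 0 := by
  have : act (1 : PSL) UpperHalfPlane.I = UpperHalfPlane.I := one_smul SL(2, ℝ) UpperHalfPlane.I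
  rw [quasi_eq, halfAngle_one, map_one, this, shift_self, sub_zero]

theorem quasi_inv (a : PSLTilde) : quasi a⁻¹ = -quasi a := by
  have h := quasi_mul a a⁻¹
  have : act (1 : PSL) UpperHalfPlane.I = UpperHalfPlane.I := one_smul SL(2, ℝ) UpperHalfPlane.I
  rw [mul_inv_cancel, quasi_one, map_one, this, shift_self,
    shift_comm UpperHalfPlane.I (act (proj a) UpperHalfPlane.I)] at h
  linarith

theorem quasi_zeta_zpow_mul (k : ℤ) (a : PSLTilde) :
    quasi (zeta ^ k * a) = k * Real.pi + quasi a := by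
  rw [quasi_eq, quasi_eq, halfAngle_mul_of_proj_eq_one (proj_zeta_zpow k), halfAngle_zeta_zpow,
    map_mul, proj_zeta_zpow, one_mul]
  ring

/-! ## The twist -/

theorem UnitTangent.vec_ne_zero (V : UnitTangent) : V.vec ≠ 0 := fun h => by
  have := V.norm_vec
  rw [h, norm_zero] at this
  exact V.base.im_pos.ne this

theorem coe_arg_smul_vec (A : SL(2, ℝ)) (V : UnitTangent) :
    (arg (A • V).vec : Real.Angle) =
      arg V.vec - ((arg (den A V.base) : Real.Angle) + arg (den A V.base)) := by
  rw [smul_vec, Complex.arg_div_coe_angle V.vec_ne_zero (pow_ne_zero _ (den_ne_zero _ _)),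
    Complex.arg_pow_coe_angle, two_nsmul]

theorem coe_arg_rotate_vec (V : UnitTangent) (s : ℝ) :
    (arg (V.rotate s).vec : Real.Angle) = s + arg V.vec := by
  change (arg (Complex.exp (s * Complex.I) * V.vec) : Real.Angle) = _
  rw [Complex.arg_mul_coe_angle (Complex.exp_ne_zero _) V.vec_ne_zero]
  have h := coe_arg_exp 1 one_pos s
  rw [Complex.ofReal_one, one_mul] at h
  rw [h]

theorem arg_upward_vec (s : ℝ) : arg (upward s).vec = Real.pi / 2 := by
  have h : (upward s).vec = (Real.exp s : ℝ) * Complex.I := by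
    apply Complex.ext <;> simp [upward, -Complex.ofReal_exp]
  rw [h, Complex.arg_real_mul _ (Real.exp_pos s), Complex.arg_I]

theorem shift_upward (s t : ℝ) : shift (upward s).base (upward t).base = 0 :=
  Complex.arg_eq_zero_iff.mpr ⟨(kern_re_pos _ _).le, by rw [kern_im]; exact sub_self 0⟩

theorem IsTwist.eq {a : PSLTilde} {y : ℍ} {τ : ℝ} (h : IsTwist a y τ) :
    τ = 2 * halfTwist a y := by
  obtain ⟨C, l, V, -, hy, ⟨f, rfl, hV⟩, θ, hθ, rfl⟩ := h
  obtain ⟨A, ψ, hA, hf, hψ, hψ1, harg⟩ := exists_matrix_path f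
  have hproj : proj (f : pathHomotopy.Quotient) = QuotientGroup.mk (A 1) := hf 1
  rw [halfTwist_eq hproj, ← hψ1]
  change _ = 2 * halfTwistAlong (A 1) (ψ 1) y
  refine (eq_of_coe_angle_eq (u := fun t => 2 * halfTwistAlong (A t) (ψ t) y)
    (v := fun t => θ t - θ 0) ((continuous_halfTwistAlong A ψ y).const_mul 2 :)
    (by fun_prop) (fun t => ?_) ?_ 1).symm
  · have hVt : V t = A t • V 0 := by rw [hV t, hf t, mk_smul]
    have hb : ∀ t, (V t).base = C • (upward (l * t)).base := fun t => by rw [hθ t]; rfl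
    have hAy : A t • y = C • (upward (l * t)).base := by
      rw [← hb, hVt, smul_base, hy]
    have hv : ∀ t : I, (arg (V t).vec : Real.Angle) = θ t + (((Real.pi / 2 : ℝ) : Real.Angle) -
        ((arg (den C (upward (l * t)).base) : Real.Angle) +
          arg (den C (upward (l * t)).base))) := fun t => by
      rw [hθ t, coe_arg_rotate_vec, geodesicField, coe_arg_smul_vec, arg_upward_vec]
    have e := coe_arg_smul_vec (A t) (V 0)
    rw [← hVt, hv, hv, hy] at e
    have es : (shift y (A t • y) : Real.Angle) =
        arg (den C (upward (l * (0 : I))).base) - arg (den C (upward (l * t)).base) := by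
      rw [hAy, ← hy, hb 0, shift_smul, shift_upward, zero_sub, Real.Angle.coe_neg, coe_denTurn]
      abel
    have e2 := coe_halfTwistAlong (harg t) y
    rw [displacement, Complex.arg_mul_coe_angle (den_ne_zero _ _) (kern_ne_zero _ _)] at e2
    change _ = -((arg (den (A t) y) : Real.Angle) + (shift y (A t • y) : Real.Angle)) at e2
    rw [es] at e2
    rw [two_mul, Real.Angle.coe_add, e2, Real.Angle.coe_sub, ← sub_eq_zero]
    rw [← sub_eq_zero] at e
    rw [← neg_eq_zero, ← e]
    abel
  · simp [hA, hψ, halfTwistAlong_one]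

theorem smul_rotate (A : SL(2, ℝ)) (V : UnitTangent) (s : ℝ) :
    A • V.rotate s = (A • V).rotate s :=
  UnitTangent.ext rfl (mul_div_assoc _ _ _)

theorem upward_zero_base : (upward 0).base = UpperHalfPlane.I := by
  apply UpperHalfPlane.ext
  apply Complex.ext <;> simp [upward]

theorem rotMatrix_smul_upward (s : ℝ) : rotMatrix s • upward 0 = (upward 0).rotate (2 * s) := by
  refine UnitTangent.ext ?_ ?_
  · rw [smul_base, upward_zero_base, rotMatrix_smul_I]
    exact upward_zero_base.symm
  · rw [smul_vec, upward_zero_base, den_rotMatrix,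
      div_eq_iff (pow_ne_zero _ (Complex.exp_ne_zero _))]
    change _ = Complex.exp (↑(2 * s) * Complex.I) * _ * _
    rw [mul_right_comm, ← Complex.exp_nat_mul, ← Complex.exp_add]
    have : ((2 * s : ℝ) : ℂ) * Complex.I + (2 : ℕ) * (((-s : ℝ) : ℂ) * Complex.I) = 0 := by
      push_cast; ring
    rw [this, Complex.exp_zero, one_mul]

theorem upperMatrix_smul_I (x u : ℝ) :
    ((upperMatrix x u • UpperHalfPlane.I : ℍ) : ℂ) = x + Real.exp u * Complex.I := by
  have h := iwasawa_smul_I (x, u, 0)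
  rwa [iwasawa, rotMatrix_zero, mul_one] at h

theorem upperMatrix_smul_upward (u : ℝ) : upperMatrix 0 u • upward 0 = upward u := by
  refine UnitTangent.ext ?_ ?_
  · apply UpperHalfPlane.ext
    rw [smul_base, upward_zero_base, upperMatrix_smul_I]
    apply Complex.ext <;> simp [upward, -Complex.ofReal_exp]
  · have h : ∀ s, (upward s).vec = (Real.exp s : ℝ) * Complex.I := fun s => by
      apply Complex.ext <;> simp [upward, -Complex.ofReal_exp]
    have hd : den (upperMatrix 0 u) (upward 0).base = (Real.exp (-(u / 2)) : ℝ) := by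
      simp [den, upperMatrix]
    rw [smul_vec, h, h, hd, div_eq_iff (by simp), Real.exp_zero, mul_right_comm,
      ← Complex.ofReal_pow, ← Complex.ofReal_mul, ← Real.exp_nat_mul, ← Real.exp_add]
    congr 3
    push_cast
    rw [← Real.exp_zero]
    congr 1
    ring

/-- Any two points lie on a geodesic. -/
theorem exists_geodesic (y w : ℍ) : ∃ (C : SL(2, ℝ)) (l : ℝ), 0 ≤ l ∧
    C • UpperHalfPlane.I = y ∧ C • (upward l).base = w := by
  set N := upperMatrix y.re (Real.log y.im) with hN
  have hNI : N • UpperHalfPlane.I = y := by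
    apply UpperHalfPlane.ext
    rw [hN, upperMatrix_smul_I, Real.exp_log y.im_pos]
    apply Complex.ext <;> simp
  set v := N⁻¹ • w with hv
  have hquarter : ∀ z : ℍ, ((rotMatrix (Real.pi / 2) • z : ℍ) : ℂ) = -(z : ℂ)⁻¹ := fun z => by
    rw [coe_smul]; simp [rotMatrix, den, div_neg]
  obtain ⟨s, hs⟩ : ∃ s : ℝ, (rotMatrix s • v).re = 0 := by
    have hcont : Continuous fun s : ℝ => (rotMatrix s • v).re :=
      Complex.continuous_re.comp ((continuous_coe_smul v).comp continuous_rotMatrix)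
    have h0 : (rotMatrix 0 • v).re = v.re := by rw [rotMatrix_zero, one_smul]
    have h1 : (rotMatrix (Real.pi / 2) • v).re = -(v.re / Complex.normSq v) := by
      change ((rotMatrix (Real.pi / 2) • v : ℍ) : ℂ).re = _
      rw [hquarter, Complex.neg_re, Complex.inv_re]; rfl
    have hn : 0 < Complex.normSq v := Complex.normSq_pos.mpr v.ne_zero
    have := intermediate_value_uIcc (a := 0) (b := Real.pi / 2) (hcont.continuousOn)
    have hmem : (0 : ℝ) ∈ Set.uIcc (rotMatrix 0 • v).re (rotMatrix (Real.pi / 2) • v).re := by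
      rw [h0, h1, Set.mem_uIcc]
      rcases le_total 0 v.re with h | h
      · exact Or.inr ⟨neg_nonpos.mpr (div_nonneg h hn.le), h⟩
      · exact Or.inl ⟨h, neg_nonneg.mpr (div_nonpos_of_nonpos_of_nonneg h hn.le)⟩
    obtain ⟨s, -, hs⟩ := this hmem
    exact ⟨s, hs⟩
  obtain ⟨R, hR, l, hl, hRl⟩ : ∃ R : SL(2, ℝ), R • UpperHalfPlane.I = UpperHalfPlane.I ∧
      ∃ l, 0 ≤ l ∧ R • v = (upward l).base := by
    have hup : ∀ z : ℍ, z.re = 0 → z = (upward (Real.log z.im)).base := fun z hz => by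
      apply UpperHalfPlane.ext
      apply Complex.ext
      · exact hz
      · exact (Real.exp_log z.im_pos).symm
    rcases le_total 1 (rotMatrix s • v).im with h | h
    · exact ⟨rotMatrix s, rotMatrix_smul_I s, _, Real.log_nonneg h, hup _ hs⟩
    · have hinv : ((rotMatrix (Real.pi / 2) • rotMatrix s • v : ℍ) : ℂ) =
          ((rotMatrix s • v).im⁻¹ : ℝ) * Complex.I := by
        have : ((rotMatrix s • v : ℍ) : ℂ) = ((rotMatrix s • v).im : ℝ) * Complex.I := by
          apply Complex.ext
          · simpa using hs
          · simp
        rw [hquarter, this, mul_inv, Complex.inv_I, Complex.ofReal_inv]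
        ring
      have hre : (rotMatrix (Real.pi / 2) • rotMatrix s • v).re = 0 := by
        have := congrArg Complex.re hinv
        simpa using this
      have him : (rotMatrix (Real.pi / 2) • rotMatrix s • v).im = (rotMatrix s • v).im⁻¹ := by
        have := congrArg Complex.im hinv
        simpa using this
      refine ⟨rotMatrix (Real.pi / 2) * rotMatrix s, ?_, _, ?_, (mul_smul _ _ _).trans
        (hup _ hre)⟩
      · rw [mul_smul, rotMatrix_smul_I, rotMatrix_smul_I]
      · rw [him]
        exact Real.log_nonneg ((one_le_inv₀ (UpperHalfPlane.im_pos _)).mpr h)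
  refine ⟨N * R⁻¹, l, hl, ?_, ?_⟩
  · rw [mul_smul, inv_smul_eq_iff.mpr hR.symm, hNI]
  · rw [mul_smul, ← hRl, inv_smul_smul, hv, smul_inv_smul]

theorem mk_rotMatrix_eq_of_frameAngle_eq {g : PSL}
    (hg : act g UpperHalfPlane.I = UpperHalfPlane.I) {s : ℝ}
    (h : frameAngle g = ((2 * s : ℝ) : Real.Angle)) : QuotientGroup.mk (rotMatrix s) = g := by
  have := mk_iwasawa_coords h
  have hu : upperMatrix 0 0 = 1 := by
    have := iwasawa_zero
    rwa [iwasawa, Prod.snd_zero, Prod.snd_zero, rotMatrix_zero, mul_one] at this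
  simpa [coords, hg, iwasawa, hu] using this

theorem continuous_upperMatrix : Continuous (upperMatrix 0) := by
  have h : upperMatrix 0 = fun u => iwasawa (0, u, 0) :=
    funext fun u => by rw [iwasawa, rotMatrix_zero, mul_one]
  rw [h]
  exact continuous_iwasawa.comp (by fun_prop)

/-- The path of isometries that moves `C • i` along a geodesic while turning with constant speed. -/
def screwPath (C : SL(2, ℝ)) (l s : ℝ) : C(I, SL(2, ℝ)) :=
  ⟨fun t => C * (upperMatrix 0 (l * t) * rotMatrix (s * t)) * C⁻¹,
    (continuous_const.mul ((continuous_upperMatrix.comp (by fun_prop)).mul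
      (continuous_rotMatrix.comp (by fun_prop)))).mul continuous_const⟩

theorem screwPath_zero (C : SL(2, ℝ)) (l s : ℝ) : screwPath C l s 0 = 1 := by
  have hu : upperMatrix 0 0 = 1 := by
    have := iwasawa_zero
    rwa [iwasawa, Prod.snd_zero, Prod.snd_zero, rotMatrix_zero, mul_one] at this
  simp [screwPath, hu, rotMatrix_zero]

theorem isTwist_screwPath (C : SL(2, ℝ)) {l : ℝ} (hl : 0 ≤ l) (s : ℝ) :
    IsTwist (cls (screwPath C l s) (screwPath_zero C l s)) (C • UpperHalfPlane.I) (2 * s) := by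
  have h0 : screwPath C l s 0 • C • upward 0 = C • upward 0 := by rw [screwPath_zero, one_smul]
  refine ⟨C, l, fun t => screwPath C l s t • C • upward 0, hl, ?_, ⟨_, rfl, fun t => ?_⟩,
    ⟨fun t => 2 * (s * t), by fun_prop⟩, fun t => ?_, by simp⟩
  · dsimp only
    rw [h0, smul_base, upward_zero_base]
  · dsimp only
    rw [h0]
    rfl
  · change (C * (upperMatrix 0 (l * t) * rotMatrix (s * t)) * C⁻¹) • C • upward 0 =
      (C • upward (l * t)).rotate (2 * (s * t))
    rw [mul_smul, inv_smul_smul, mul_smul, mul_smul, rotMatrix_smul_upward, smul_rotate,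
      smul_rotate, upperMatrix_smul_upward]

theorem isTwist_halfTwist (a : PSLTilde) (y : ℍ) : IsTwist a y (2 * halfTwist a y) := by
  obtain ⟨B, hB⟩ := QuotientGroup.mk_surjective (proj a)
  obtain ⟨C, l, hl, hC, hCl⟩ := exists_geodesic y (B • y)
  set M := (upperMatrix 0 l)⁻¹ * (C⁻¹ * B * C) with hM
  have hMI : M • UpperHalfPlane.I = UpperHalfPlane.I := by
    rw [hM, mul_smul, inv_smul_eq_iff, mul_smul, mul_smul, hC, ← hCl, inv_smul_smul,
      ← upperMatrix_smul_upward, smul_base, upward_zero_base]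
  have hB' : B = C * (upperMatrix 0 l * M) * C⁻¹ := by rw [hM]; group
  have hend : ∀ s : ℝ, frameAngle (QuotientGroup.mk M) = ((2 * s : ℝ) : Real.Angle) →
      proj (cls (screwPath C l s) (screwPath_zero C l s)) = proj a := fun s hs => by
    have h1 := mk_rotMatrix_eq_of_frameAngle_eq (g := QuotientGroup.mk M) hMI hs
    have h2 : screwPath C l s 1 = C * (upperMatrix 0 l * rotMatrix s) * C⁻¹ := by
      simp [screwPath]
    rw [proj_cls, ← hB, h2, hB']
    rcases mk_eq_mk_iff.mp h1 with h | h
    · rw [h]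
    · rw [h, mul_neg, mul_neg, neg_mul, mk_neg]
  have htw : ∀ s : ℝ, proj (cls (screwPath C l s) (screwPath_zero C l s)) = proj a →
      halfAngle (cls (screwPath C l s) (screwPath_zero C l s)) - s =
        halfAngle a - halfTwist a y := fun s hs => by
    have h := (isTwist_screwPath C hl s).eq
    rw [hC, halfTwist, hs] at h
    rw [halfTwist]
    linarith
  obtain ⟨r, hr⟩ : ∃ r : ℝ, (r : Real.Angle) = frameAngle (QuotientGroup.mk M) :=
    ⟨_, Real.Angle.coe_toReal _⟩
  have hr' : frameAngle (QuotientGroup.mk M) = ((2 * (r / 2) : ℝ) : Real.Angle) := by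
    rw [← hr]; congr 1; ring
  obtain ⟨k, hk⟩ := exists_eq_zeta_zpow
    (a := a * (cls (screwPath C l (r / 2)) (screwPath_zero C l (r / 2)))⁻¹)
    (by rw [map_mul, map_inv, hend _ hr', mul_inv_cancel])
  have ha : halfAngle a = k * Real.pi + halfAngle (cls (screwPath C l (r / 2))
      (screwPath_zero C l (r / 2))) := by
    rw [mul_inv_eq_iff_eq_mul.mp hk, halfAngle_mul_of_proj_eq_one (proj_zeta_zpow k),
      halfAngle_zeta_zpow]
  have hs : halfTwist a y = r / 2 + k * Real.pi := by
    have := htw _ (hend _ hr')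
    linarith
  have hfa : frameAngle (QuotientGroup.mk M) = ((2 * halfTwist a y : ℝ) : Real.Angle) := by
    rw [hs, hr', Real.Angle.angle_eq_iff_two_pi_dvd_sub]
    exact ⟨-k, by push_cast; ring⟩
  have heq : cls (screwPath C l (halfTwist a y)) (screwPath_zero C l _) = a :=
    eq_of_proj_eq_of_halfAngle_eq (hend _ hfa) (by linarith [htw _ (hend _ hfa)])
  have := isTwist_screwPath C hl (halfTwist a y)
  rwa [heq, hC] at this

theorem twist_eq (a : PSLTilde) (y : ℍ) : twist a y = 2 * halfTwist a y :=
  (Classical.epsilon_spec ⟨_, isTwist_halfTwist a y⟩ : IsTwist a y (twist a y)).eq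

theorem abs_quasi_lt_of_abs_twist_lt {a : PSLTilde} {p : ℍ} (h : |twist a p| < Real.pi) :
    |quasi a| < Real.pi / 2 := by
  refine abs_halfTwist_lt_of_abs_halfTwist_lt (p := p) ?_ _
  rw [twist_eq, abs_mul, abs_two] at h
  linarith

/-! ## Estimates for products -/

theorem abs_quasi_comm_mul_sub_le (a b w : PSLTilde) :
    |quasi (comm a b * w) - quasi w| ≤ 2 * Real.pi := by
  have e : comm a b * w = a * (b * (a⁻¹ * (b⁻¹ * w))) := by simp only [comm, mul_assoc]
  have h1 := abs_lt.mp (abs_quasi_mul_sub_lt a (b * (a⁻¹ * (b⁻¹ * w))))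
  have h2 := abs_lt.mp (abs_quasi_mul_sub_lt b (a⁻¹ * (b⁻¹ * w)))
  have h3 := abs_lt.mp (abs_quasi_mul_sub_lt a⁻¹ (b⁻¹ * w))
  have h4 := abs_lt.mp (abs_quasi_mul_sub_lt b⁻¹ w)
  rw [quasi_inv] at h3 h4
  rw [e, abs_le]
  constructor <;> linarith

theorem abs_quasi_mul_sub_le_pi {a : PSLTilde} (ha : |quasi a| < Real.pi / 2) (w : PSLTilde) :
    |quasi (a * w) - quasi w| ≤ Real.pi := by
  have h := abs_lt.mp (abs_quasi_mul_sub_lt a w)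
  have h' := abs_lt.mp ha
  rw [abs_le]
  constructor <;> linarith

theorem abs_quasi_prod_mul_sub_le {c : ℝ} {k : ℕ} {x : Fin k → PSLTilde}
    (hx : ∀ i w, |quasi (x i * w) - quasi w| ≤ c) (w : PSLTilde) :
    |quasi ((List.ofFn x).prod * w) - quasi w| ≤ k * c := by
  induction k with
  | zero => simp
  | succ k ih =>
    rw [List.ofFn_succ, List.prod_cons, mul_assoc]
    have h1 := abs_le.mp (hx 0 ((List.ofFn fun i : Fin k => x i.succ).prod * w))
    have h2 := abs_le.mp (ih fun i => hx i.succ)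
    rw [abs_le]
    push_cast
    constructor <;> linarith

theorem abs_lt_of_mul_pi_lt {m : ℤ} {k : ℕ} (h : |(m : ℝ) * Real.pi| < k * Real.pi) :
    |m| < k := by
  rw [abs_mul, abs_of_pos Real.pi_pos] at h
  have := lt_of_mul_lt_mul_right h Real.pi_pos.le
  exact_mod_cast this

theorem abs_lt_of_prod_comm_mul_prod_eq {g n : ℕ} {a b : Fin (g + 1) → PSLTilde}
    {x : Fin n → PSLTilde} (hx : ∀ j, |quasi (x j)| < Real.pi / 2) {m : ℤ}
    (h : (List.ofFn fun i => comm (a i) (b i)).prod * (List.ofFn x).prod = zeta ^ m) :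
    |m| < ((2 * g + n + 1 : ℕ) : ℤ) := by
  set Y := (List.ofFn x).prod with hY
  rw [List.ofFn_succ', List.concat_eq_append, List.prod_append, List.prod_singleton] at h
  generalize a (Fin.last g) = a', b (Fin.last g) = b' at h
  set X := (List.ofFn fun i : Fin g => comm (a i.castSucc) (b i.castSucc)).prod with hX
  have e : X * (a' * (b' * a'⁻¹)) = zeta ^ m * (Y⁻¹ * b') := by
    rw [← h, comm]; group
  have h1 := abs_le.mp (abs_quasi_prod_mul_sub_le
    (fun i : Fin g => abs_quasi_comm_mul_sub_le (a i.castSucc) (b i.castSucc))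
    (a' * (b' * a'⁻¹)))
  have h2 := abs_le.mp (abs_quasi_prod_mul_sub_le (fun j => abs_quasi_mul_sub_le_pi (hx j))
    (Y⁻¹ * b'))
  rw [← hX, e, quasi_zeta_zpow_mul] at h1
  rw [← hY, mul_inv_cancel_left] at h2
  have h3 := abs_lt.mp (abs_quasi_mul_sub_lt a' (b' * a'⁻¹))
  have h4 := abs_lt.mp (abs_quasi_mul_sub_lt b' a'⁻¹)
  rw [quasi_inv] at h4
  refine abs_lt_of_mul_pi_lt ?_
  rw [abs_lt]
  push_cast
  constructor <;> linarith

theorem abs_lt_of_prod_eq {n : ℕ} {x : Fin (n + 2) → PSLTilde}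
    (hx : ∀ j, |quasi (x j)| < Real.pi / 2) {m : ℤ} (h : (List.ofFn x).prod = zeta ^ m) :
    |m| < ((n + 1 : ℕ) : ℤ) := by
  rw [List.ofFn_succ, List.ofFn_succ, List.prod_cons, List.prod_cons] at h
  have h1 := abs_le.mp (abs_quasi_prod_mul_sub_le
    (fun j : Fin n => abs_quasi_mul_sub_le_pi (hx j.succ.succ)) (x 0))
  have e : (List.ofFn fun j : Fin n => x j.succ.succ).prod * x 0 =
      zeta ^ m * (x (Fin.succ 0))⁻¹ := by
    have hc := (commute_of_proj_eq_one (proj_zeta_zpow m) (x 0 * x (Fin.succ 0))⁻¹).eq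
    rw [← mul_assoc, ← eq_inv_mul_iff_mul_eq] at h
    rw [h, ← hc]
    group
  rw [e, quasi_zeta_zpow_mul, quasi_inv] at h1
  have h2 := abs_lt.mp (hx 0)
  have h3 := abs_lt.mp (hx (Fin.succ 0))
  refine abs_lt_of_mul_pi_lt ?_
  rw [abs_lt]
  push_cast
  constructor <;> linarith

theorem quasi_zeta_zpow (m : ℤ) : quasi (zeta ^ m) = m * Real.pi := by
  have := quasi_zeta_zpow_mul m 1
  rwa [mul_one, quasi_one, add_zero] at this

theorem abs_le_abs_euler_of_eq {g n : ℕ} {a b : Fin g → PSLTilde} {x : Fin n → PSLTilde}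
    (hx : ∀ j, |quasi (x j)| < Real.pi / 2) {m : ℤ}
    (h : (List.ofFn fun i => comm (a i) (b i)).prod * (List.ofFn x).prod = zeta ^ m) :
    |m| ≤ |(2 - 2 * g - n : ℤ)| := by
  rcases g with _ | g
  · rw [List.ofFn_zero, List.prod_nil, one_mul] at h
    have hm : ∀ {r : ℝ}, |r| < Real.pi / 2 → (m : ℝ) * Real.pi = r → m = 0 := fun {r} hr e => by
      have : |m| < ((1 : ℕ) : ℤ) := abs_lt_of_mul_pi_lt (by
        rw [e, Nat.cast_one, one_mul]; linarith [Real.pi_pos])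
      exact Int.abs_lt_one_iff.mp this
    rcases n with _ | _ | n
    · rw [List.ofFn_zero, List.prod_nil] at h
      have := hm (r := 0) (by rw [abs_zero]; exact Real.pi_div_two_pos)
        (by rw [← quasi_zeta_zpow, ← h, quasi_one])
      simp [this]
    · have := hm (hx 0) (by rw [← quasi_zeta_zpow, ← h]; simp)
      simp [this]
    · have := abs_lt_of_prod_eq hx h
      push_cast at this ⊢
      rw [abs_sub_comm]
      refine le_trans ?_ (le_abs_self _)
      linarith
  · have := abs_lt_of_prod_comm_mul_prod_eq hx h
    push_cast at this ⊢
    have e : (2 - 2 * ((g : ℤ) + 1) - n) = -(2 * g + n) := by ring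
    rw [e, abs_neg]
    refine le_trans ?_ (le_abs_self _)
    linarith

/-! ## The relative Euler class -/

theorem eulerChar_eq (g n : ℕ) : eulerChar g n = 2 - 2 * g - n := by
  have hV : Nat.card (Vertex n) = n + 1 := by
    let e : Vertex n ≃ Option (Fin n) :=
      { toFun := fun v => match v with
          | .base => none
          | .w j => some j
        invFun := fun v => match v with
          | none => .base
          | some j => .w j
        left_inv := fun v => by cases v <;> rfl
        right_inv := fun v => by cases v <;> rfl }
    rw [Nat.card_congr e]
    simp
  have hE : Nat.card (Edge g n) = g + g + (n + n) := by
    let e : Edge g n ≃ (Fin g ⊕ Fin g) ⊕ (Fin n ⊕ Fin n) :=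
      { toFun := fun v => match v with
          | .a i => .inl (.inl i)
          | .b i => .inl (.inr i)
          | .c j => .inr (.inl j)
          | .d j => .inr (.inr j)
        invFun := fun v => match v with
          | .inl (.inl i) => .a i
          | .inl (.inr i) => .b i
          | .inr (.inl j) => .c j
          | .inr (.inr j) => .d j
        left_inv := fun v => by cases v <;> rfl
        right_inv := fun v => by rcases v with (v | v) | (v | v) <;> rfl }
    rw [Nat.card_congr e]
    simp
  rw [eulerChar, hV, hE]
  simp
  ring

theorem lift_comm {X G : Type*} [Group G] (f : X → G) (x y : X) :
    FreeGroup.lift f (comm (FreeGroup.of x) (FreeGroup.of y)) = comm (f x) (f y) := by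
  simp [comm]

theorem lift_attachingWord {g n : ℕ} {G : Type*} [Group G] (f : Edge g n → G)
    (hd : ∀ j x, Commute (f (.d j)) x) (F : Face) :
    FreeGroup.lift f (attachingWord g n F) =
      (List.ofFn fun i => comm (f (.a i)) (f (.b i))).prod * (List.ofFn fun j => f (.c j)).prod := by
  have h : ∀ j, FreeGroup.lift f
      (FreeGroup.of (.d j) * FreeGroup.of (.c j) * (FreeGroup.of (.d j))⁻¹) = f (.c j) :=
    fun j => by simp [(hd j (f (.c j))).eq]
  rw [attachingWord, map_mul, map_list_prod, map_list_prod, List.map_ofFn, List.map_ofFn]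
  simp only [Function.comp_def, h, lift_comm]

theorem map_relator {g n : ℕ} {G : Type*} [Group G] (φ : FreeGroup (Generator g n) →* G) :
    φ (relator g n) = (List.ofFn fun i => comm (φ (FreeGroup.of (.α i)))
      (φ (FreeGroup.of (.β i)))).prod * (List.ofFn fun j => φ (FreeGroup.of (.γ j))).prod := by
  rw [relator, map_mul, map_list_prod, map_list_prod, List.map_ofFn, List.map_ofFn]
  simp only [Function.comp_def, comm, map_mul, map_inv]

theorem lift_edgeClass_attachingWord (g n : ℕ) (F : Face) :
    FreeGroup.lift (edgeClass (g := g) (n := n)) (attachingWord g n F) = 1 := by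
  have h : (PresentedGroup.mk {relator g n}) (relator g n) = 1 :=
    PresentedGroup.one_of_mem (Set.mem_singleton _)
  rw [map_relator] at h
  rw [lift_attachingWord _ fun j x => Commute.one_left x]
  exact h

theorem comm_mul_central {G : Type*} [Group G] {c d : G} (hc : ∀ x, Commute c x)
    (hd : ∀ x, Commute d x) (a b : G) : comm (c * a) (d * b) = comm a b := by
  have h1 := (hc (a * (d * b) * a⁻¹)).eq
  have h2 := (hd (a * b * a⁻¹)).eq
  have e : comm (c * a) (d * b) = (c * (a * (d * b) * a⁻¹)) * c⁻¹ * b⁻¹ * d⁻¹ := by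
    simp only [comm]; group
  have e' : a * (d * b) * a⁻¹ = d * (a * b * a⁻¹) := by
    rw [← mul_assoc a, ← (hd a).eq]; group
  rw [e, h1, mul_inv_cancel_right, e', h2, mul_assoc _ d, ← mul_assoc, mul_assoc _ _ b⁻¹,
    (hd b⁻¹).eq, ← mul_assoc, mul_inv_cancel_right, comm]

/-- The Milnor–Wood inequality for an obstruction cochain. -/
theorem IsObstructionCochain.abs_le {g n : ℕ} {ρ : SurfaceGroup g n →* PSL} {γ : Fin n → PSLTilde}
    {o : Face → ℤ} (ho : IsObstructionCochain ρ γ o)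
    (hγ : ∀ j, |quasi (γ j)| < Real.pi / 2) : |o ()| ≤ |eulerChar g n| := by
  obtain ⟨h, hρ, hc, hF⟩ := ho
  have hF := hF ()
  rw [lift_attachingWord _ fun j => commute_of_proj_eq_one ((hρ _).trans (map_one ρ))] at hF
  simp only [hc] at hF
  rw [eulerChar_eq]
  exact abs_le_abs_euler_of_eq hγ hF

theorem IsObstructionCochain.eq {g n : ℕ} {ρ : SurfaceGroup g n →* PSL} {γ : Fin n → PSLTilde}
    {o o' : Face → ℤ} (ho : IsObstructionCochain ρ γ o) (ho' : IsObstructionCochain ρ γ o') :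
    o = o' := by
  obtain ⟨h, hρ, hc, hF⟩ := ho
  obtain ⟨h', hρ', hc', hF'⟩ := ho'
  funext F
  refine zeta_zpow_injective ?_
  simp only [← hF, ← hF']
  rw [lift_attachingWord _ fun j => commute_of_proj_eq_one ((hρ _).trans (map_one ρ)),
    lift_attachingWord _ fun j => commute_of_proj_eq_one ((hρ' _).trans (map_one ρ))]
  simp only [hc, hc']
  have hcen : ∀ e x, Commute (h e * (h' e)⁻¹) x := fun e =>
    commute_of_proj_eq_one (by rw [map_mul, map_inv, hρ, hρ', mul_inv_cancel])
  have : ∀ i, comm (h (.a i)) (h (.b i)) = comm (h' (.a i)) (h' (.b i)) := fun i => by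
    have := comm_mul_central (hcen (.a i)) (hcen (.b i)) (h' (.a i)) (h' (.b i))
    rwa [inv_mul_cancel_right, inv_mul_cancel_right] at this
  simp only [this]

theorem exists_isObstructionCochain {g n : ℕ} {ρ : SurfaceGroup g n →* PSL}
    {γ : Fin n → PSLTilde} (hγ : ∀ j, proj (γ j) = ρ (boundaryClass j)) :
    ∃ o, IsObstructionCochain ρ γ o := by
  choose lift hlift using proj_surjective
  let h : Edge g n → PSLTilde := fun e => match e with
    | .c j => γ j
    | e => lift (ρ (edgeClass e))
  have hρ : ∀ e, proj (h e) = ρ (edgeClass e) := fun e => by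
    cases e
    case c j => exact hγ j
    all_goals exact hlift _
  have hker : ∀ F, proj (FreeGroup.lift h (attachingWord g n F)) = 1 := fun F => by
    have e : proj.comp (FreeGroup.lift h) = ρ.comp (FreeGroup.lift edgeClass) :=
      FreeGroup.ext_hom _ _ fun e => by simp [hρ]
    have := DFunLike.congr_fun e (attachingWord g n F)
    rw [MonoidHom.comp_apply, MonoidHom.comp_apply, lift_edgeClass_attachingWord, map_one] at this
    exact this
  choose o ho using fun F => exists_eq_zeta_zpow (hker F)
  exact ⟨o, h, hρ, fun _ => rfl, ho⟩

end MilnorWood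
end

theorem mainTheorem9 (g n : ℕ) (ρ : MilnorWood.SurfaceGroup g n →* MilnorWood.PSL)
    (γ : Fin n → MilnorWood.PSLTilde)
    (hγ : ∀ j, MilnorWood.proj (γ j) = ρ (MilnorWood.boundaryClass j))
    (htwist : ∀ j, ∃ p : ℍ, |MilnorWood.twist (γ j) p| < Real.pi) :
    ∃ E : MilnorWood.RelCohomology₂ g n,
      MilnorWood.IsRelEulerClass ρ γ E ∧
      (∀ E', MilnorWood.IsRelEulerClass ρ γ E' → E' = E) ∧
      |MilnorWood.evalFundamental g n E| ≤ |MilnorWood.eulerChar g n| := by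
  obtain ⟨o, ho⟩ := MilnorWood.exists_isObstructionCochain hγ
  refine ⟨QuotientAddGroup.mk o, ⟨o, ho, rfl⟩, ?_, ?_⟩
  · rintro _ ⟨o', ho', rfl⟩
    rw [ho'.eq ho]
  · have e : MilnorWood.evalFundamental g n (QuotientAddGroup.mk o) = o () :=
      Fintype.sum_unique o
    rw [e]
    exact ho.abs_le fun j => MilnorWood.abs_quasi_lt_of_abs_twist_lt (htwist j).choose_spec
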